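/- Let $S^3\subset\mathbb R^4$ carry its standard surface measure and consider real-valued functions. For $n\ge 1$ let $E_n\subset L^2(S^3)$ be the space of spherical harmonics of degree $n-1$, i.e. of restrictions to $S^3$ of harmonic homogeneous polynomials of degree $n-1$ in four variables, with the $L^2$ inner product. Then $N_n:=\dim E_n=n^2$ for all $n\ge1$. Fix an orthonormal basis $(f_{n,k})_{1\le k\le N_n}$ of $E_n$. Identify the $L^2$-unit sphere of $E_n$ with the unit sphere of $\mathbb R^{N_n}$ through coordinates in this basis, and let $p_n$ be its uniform probability measure. Identify the set of orthonormal bases $(b_k)_{1\le k\le N_n}$ of $E_n$ with the orthogonal group $O(N_n)$, the coordinates of $b_k$ being the $k$-th column of the matrix, and let $\nu_n$ be the Haar probability measure. A median of a real function $F$ under a probability measure $P$ is a real number $M$ with $P(F\ge M)\ge\frac12$ and $P(F\le M)\ge\frac12$. (1) There are constants $c,C>0$ such that for all integers $n\ge1$, all orthonormal bases $(f_{n,k})_k$ of $E_n$ and all real $q\ge2$, the function $\|\cdot\|_{L^q(S^3)}$ has a median under $p_n$, and every such median $M_{n,q}$ satisfies $$M_{n,q}\le C\sqrt q$$ and, for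 every $r\ge0$, $$\nu_n\Big(\big\{(b_k)_{1\le k\le N_n}\ \big|\ \exists k_0,\ \big|\|b_{k_0}\|_{L^q}-M_{n,q}\big|>r\big\}\Big)\le 2N_n\,e^{-c\,n^{4/q}r^2}.$$ (2) There are a constant $C$, a sequence of real numbers $p_m\ge2$ with $p_m\to\infty$, and an orthonormal (Hilbert) basis $(e_{n,k})_{n\ge1,\,1\le k\le n^2}$ of $L^2(S^3)$ with $e_{n,k}\in E_n$ for all $n,k$, such that $$\|e_{n,k}\|_{L^{p_m}}\le C\sqrt{p_m}\qquad\text{for all } n,k,m.$$ -/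

import Mathlib

open MeasureTheory Filter Topology
open scoped ENNReal

noncomputable section

/-- The unit sphere `S^3` of Euclidean `ℝ⁴`. -/
abbrev S3 : Type := Metric.sphere (0 : EuclideanSpace ℝ (Fin 4)) 1

/-- The surface measure of `S^3` (total mass `2π²`). -/
def surf : Measure S3 := (volume : Measure (EuclideanSpace ℝ (Fin 4))).toSphere

instance : IsFiniteMeasure surf := by unfold surf; infer_instance

/-- The real Hilbert space `L²(S^3)`. -/
abbrev L2S3 : Type := Lp ℝ 2 surf

/-- The Laplacian `∑ i, ∂ᵢ²` on real polynomials in four variables. -/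
def polyLaplacian : MvPolynomial (Fin 4) ℝ →ₗ[ℝ] MvPolynomial (Fin 4) ℝ :=
  ∑ i : Fin 4, (MvPolynomial.pderiv i).toLinearMap ∘ₗ (MvPolynomial.pderiv i).toLinearMap

/-- Harmonic homogeneous polynomials of degree `d` in four variables. -/
def harmonicPoly (d : ℕ) : Submodule ℝ (MvPolynomial (Fin 4) ℝ) :=
  MvPolynomial.homogeneousSubmodule (Fin 4) ℝ d ⊓ LinearMap.ker polyLaplacian

/-- Restriction of a polynomial to `S^3`, as a continuous function. -/
def restrictS3 : MvPolynomial (Fin 4) ℝ →ₗ[ℝ] C(S3, ℝ) where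
  toFun P := ⟨fun x => MvPolynomial.eval (fun i => (x : EuclideanSpace ℝ (Fin 4)) i) P,
    (MvPolynomial.continuous_eval P).comp (by fun_prop)⟩
  map_add' P Q := by ext x; simp
  map_smul' a P := by ext x; simp

/-- `SphHarm n`: the spherical harmonics of degree `n - 1` on `S^3`, i.e. the restrictions to `S^3` of the
harmonic homogeneous polynomials of degree `n - 1` (`n ≥ 1`), as a subspace of `L²(S^3)`. -/
def SphHarm (n : ℕ+) : Submodule ℝ L2S3 :=
  (harmonicPoly ((n : ℕ) - 1)).map
    ((ContinuousMap.toLp 2 surf ℝ).toLinearMap ∘ₗ restrictS3)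

/-- The `L^q(S^3)` norm of (the class of) a function. Every element of `SphHarm n` is bounded, so the
norm is finite there. -/
def normLq (q : ℝ) (u : L2S3) : ℝ := (eLpNorm u (ENNReal.ofReal q) surf).toReal

theorem memLp_of_mem_SphHarm {n : ℕ+} {u : L2S3} (hu : u ∈ SphHarm n) (p : ℝ≥0∞) : MemLp u p surf := by
  obtain ⟨P, -, rfl⟩ := hu
  have h : MemLp (restrictS3 P) p surf :=
    MemLp.of_bound (restrictS3 P).continuous.aestronglyMeasurable ‖restrictS3 P‖
      (Eventually.of_forall fun x => (restrictS3 P).norm_coe_le_norm x)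
  exact h.ae_eq (ContinuousMap.coeFn_toLp surf (restrictS3 P)).symm

/-- The uniform probability measure on the unit sphere of Euclidean `ℝᴺ`. -/
def unifSphere (N : ℕ) : Measure (Metric.sphere (0 : EuclideanSpace ℝ (Fin N)) 1) :=
  ((volume : Measure (EuclideanSpace ℝ (Fin N))).toSphere Set.univ)⁻¹ •
    (volume : Measure (EuclideanSpace ℝ (Fin N))).toSphere

/-- `M` is a median of `F` under `μ`. -/
def IsMedian {Ω : Type*} [MeasurableSpace Ω] (μ : Measure Ω) (F : Ω → ℝ) (M : ℝ) : Prop :=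
  1 / 2 ≤ μ {x | M ≤ F x} ∧ 1 / 2 ≤ μ {x | F x ≤ M}

/-- The orthogonal group `O(N)`. -/
abbrev OGroup (N : ℕ) : Type := Matrix.orthogonalGroup (Fin N) ℝ

instance (N : ℕ) : MeasurableSpace (OGroup N) := borel _

instance (N : ℕ) : BorelSpace (OGroup N) := ⟨rfl⟩

instance (N : ℕ) : CompactSpace (OGroup N) := by
  refine isCompact_iff_compactSpace.mp (IsCompact.of_isClosed_subset
    (isCompact_univ_pi fun _ : Fin N => isCompact_univ_pi fun _ : Fin N =>
      isCompact_Icc (a := (-1 : ℝ)) (b := 1)) ?_ ?_)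
  · have : ((Matrix.orthogonalGroup (Fin N) ℝ : Submonoid _) : Set (Matrix (Fin N) (Fin N) ℝ)) =
        {A | A * star A = 1} := by
      ext A; exact Matrix.mem_unitaryGroup_iff
    rw [this]
    exact isClosed_eq (by fun_prop) continuous_const
  · intro A hA i _ j _
    have := entry_norm_bound_of_unitary (𝕜 := ℝ) hA i j
    exact abs_le.mp this

/-- The Haar probability measure on `O(N)`. -/
def haarO (N : ℕ) : Measure (OGroup N) := Measure.haarMeasure ⊤

/-- The orthonormal basis of `V` identified with `U ∈ O(N)` through the fixed orthonormal basis `f`: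
its `k`-th vector has as coordinates in `f` the `k`-th column of `U`. -/
def rotated {V : Type*} [NormedAddCommGroup V] [InnerProductSpace ℝ V] {N : ℕ}
    (f : OrthonormalBasis (Fin N) ℝ V) (U : OGroup N) (k : Fin N) : V :=
  f.repr.symm (WithLp.toLp 2 fun i => (U : Matrix (Fin N) (Fin N) ℝ) i k)

end

/-! Everything rests on concentration of measure on spheres of high dimension together with the
rotation invariance of `SphHarm n`.

Concentration comes from the midpoint Prékopa–Leindler inequality: if two subsets of the unit sphere
of `ℝᴺ` are at distance at least `ρ`, midpoints of the truncated cones over them lie in a ball of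
radius `exp (-ρ²/32)`, so the product of their measures is at most `4 exp (-Nρ²/16)`
(`unifSphere_mul_le_of_le_dist`). An `L`-Lipschitz function therefore deviates from any median by
more than `r` with probability at most `2 exp (-Nr²/(64L²))`.

On `SphHarm n`, evaluation at `x` is the inner product with a zonal harmonic. By rotation invariance
its norm does not depend on `x`, and averaging gives norm `n/√V`, where `V` is the area of the
sphere. This bounds the sup norm, and interpolation with `L²` makes the `L^q` norm Lipschitz with
constant of order `n^(1-2/q)` (`normLq_le`). With `N = n²` the ratio `N/L²` has order `n^(4/q)`.
Each column of a Haar matrix is uniform on the sphere (`haarO_sphereMap_mem`), so a union bound over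
the `n²` columns gives the estimate for bases. At a fixed point the values of a random harmonic are
sub-Gaussian uniformly in `n`, so by Fubini their `q`-th moments are at most `(C√q)^q`, and Markov's
inequality bounds the medians.

For the Hilbert basis, deviations of order `√p` for the exponents `p = m + 3` have total probability
less than one for every `n`, so one basis of each `SphHarm n` is good for all exponents. The spaces
fit together: the Fischer pairing gives dimensions and the decomposition into harmonics, integration
by parts against a Gaussian gives orthogonality, and Stone–Weierstrass gives density. -/

/-! ### Brunn–Minkowski and Prékopa–Leindler inequalities. -/

/-- One-dimensional Brunn–Minkowski inequality for midpoints. -/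
theorem volume_add_volume_le_of_midpoint {A B C : Set ℝ} (hA : MeasurableSet A)
    (hB : MeasurableSet B) (hAn : A.Nonempty) (hBn : B.Nonempty)
    (h : ∀ x ∈ A, ∀ y ∈ B, (x + y) / 2 ∈ C) :
    volume A + volume B ≤ 2 * volume C := by
  have key : ∀ K L : Set ℝ, K ⊆ A → L ⊆ B → IsCompact K → IsCompact L → K.Nonempty → L.Nonempty →
      volume K + volume L ≤ 2 * volume C := by
    intro K L hK hL cK cL nK nL
    obtain ⟨a, haK, ha⟩ := cK.exists_isGreatest nK
    obtain ⟨b, hbL, hb⟩ := cL.exists_isLeast nL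
    -- With `a = max K` and `b = min L`, the translates `K + b` and `a + L` lie in `2C` and can meet
    -- only at `a + b`.
    have h1 : (fun x => x + b) '' K ∪ (fun x => a + x) '' L ⊆ (fun x => 2 * x) '' C := by
      rintro _ (⟨x, hx, rfl⟩ | ⟨x, hx, rfl⟩)
      · exact ⟨_, h x (hK hx) b (hL hbL), by ring⟩
      · exact ⟨_, h a (hK haK) x (hL hx), by ring⟩
    have h2 : volume ((fun x => x + b) '' K) = volume K := by
      simp [Set.image_add_right]
    have h3 : volume ((fun x => a + x) '' L) = volume L := by
      simp [Set.image_add_left]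
    have h4 : volume ((fun x => 2 * x) '' C) = 2 * volume C := by
      have := Measure.addHaar_smul (volume : Measure ℝ) 2 C
      rw [Module.finrank_self, pow_one, abs_of_pos two_pos, ENNReal.ofReal_ofNat] at this
      exact this
    have hd : AEDisjoint volume ((fun x => x + b) '' K) ((fun x => a + x) '' L) := by
      refine measure_mono_null (t := {a + b}) ?_ (by simp)
      rintro _ ⟨⟨x, hx, rfl⟩, ⟨y, hy, hxy⟩⟩
      have := ha hx
      have := hb hy
      simp only [Set.mem_singleton_iff] at *
      linarith
    rw [← h2, ← h3, ← h4, ← measure_union₀ _ hd]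
    · exact measure_mono h1
    · exact ((cL.image (by fun_prop)).measurableSet).nullMeasurableSet
  obtain ⟨a, ha⟩ := hAn
  obtain ⟨b, hb⟩ := hBn
  -- Inner regularity, restricted to nonempty compact sets so that the extremal points `a` and `b`
  -- exist.
  have hsup : ∀ {S : Set ℝ}, MeasurableSet S → ∀ s ∈ S,
      volume S = ⨆ K, ⨆ (_ : K ⊆ S ∧ IsCompact K ∧ K.Nonempty), volume K := by
    intro S hS s hs
    refine le_antisymm ?_ (iSup₂_le fun K hK => measure_mono hK.1)
    conv_lhs => rw [hS.measure_eq_iSup_isCompact]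
    refine iSup₂_le fun K hK => iSup_le fun hc => ?_
    rcases K.eq_empty_or_nonempty with rfl | hn
    · simp
    · exact le_iSup₂ (f := fun K (_ : K ⊆ S ∧ IsCompact K ∧ K.Nonempty) => volume K) K ⟨hK, hc, hn⟩
  rw [hsup hA a ha, hsup hB b hb]
  refine ENNReal.biSup_add_biSup_le' ⟨{a}, by simpa⟩ ⟨{b}, by simpa⟩ ?_
  exact fun K hK L hL => key K L hK.1 hL.1 hK.2.1 hL.2.1 hK.2.2 hL.2.2

/-- Layer cake formula for functions with values in `[0, ∞]`. -/
theorem lintegral_eq_lintegral_measure_ofReal_lt {α : Type*} [MeasurableSpace α] (μ : Measure α)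
    [SFinite μ] {f : α → ℝ≥0∞} (hf : Measurable f) :
    ∫⁻ x, f x ∂μ = ∫⁻ t in Set.Ioi (0 : ℝ), μ {x | ENNReal.ofReal t < f x} := by
  have h1 : ∀ y : ℝ≥0∞, y = ∫⁻ t in Set.Ioi (0 : ℝ),
      {t : ℝ | ENNReal.ofReal t < y}.indicator 1 t := by
    intro y
    rw [lintegral_indicator_one (measurableSet_lt (by fun_prop) (by fun_prop)),
      Measure.restrict_apply (measurableSet_lt (by fun_prop) (by fun_prop))]
    rcases eq_or_ne y ⊤ with rfl | hy
    · simp [ENNReal.ofReal_lt_top]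
    · have : {t : ℝ | ENNReal.ofReal t < y} ∩ Set.Ioi 0 = Set.Ioo 0 y.toReal := by
        ext t
        simp only [Set.mem_inter_iff, Set.mem_ofPred_eq, Set.mem_Ioi, Set.mem_Ioo]
        constructor
        · rintro ⟨h, h0⟩
          exact ⟨h0, by rwa [ENNReal.ofReal_lt_iff_lt_toReal h0.le hy] at h⟩
        · rintro ⟨h0, h⟩
          exact ⟨by rwa [ENNReal.ofReal_lt_iff_lt_toReal h0.le hy], h0⟩
      rw [this, Real.volume_Ioo, sub_zero, ENNReal.ofReal_toReal hy]
  have hm : MeasurableSet {p : α × ℝ | ENNReal.ofReal p.2 < f p.1} :=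
    measurableSet_lt (by fun_prop) (by fun_prop)
  calc ∫⁻ x, f x ∂μ = ∫⁻ x, (∫⁻ t in Set.Ioi (0 : ℝ),
        Set.indicator {p : α × ℝ | ENNReal.ofReal p.2 < f p.1} 1 (x, t)) ∂μ :=
        lintegral_congr fun x => h1 (f x)
    _ = ∫⁻ t in Set.Ioi (0 : ℝ), ∫⁻ x,
        Set.indicator {p : α × ℝ | ENNReal.ofReal p.2 < f p.1} 1 (x, t) ∂μ :=
        lintegral_lintegral_swap (measurable_one.indicator hm).aemeasurable
    _ = _ := by
        refine lintegral_congr fun t => ?_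
        rw [← lintegral_indicator_one (measurableSet_lt (by fun_prop) hf)]
        rfl

theorem ENNReal.four_mul_le_add_sq (a b : ℝ≥0∞) : 4 * (a * b) ≤ (a + b) ^ 2 := by
  rcases eq_or_ne a ⊤ with rfl | ha
  · simp
  rcases eq_or_ne b ⊤ with rfl | hb
  · simp
  lift a to NNReal using ha
  lift b to NNReal using hb
  norm_cast
  rw [← NNReal.coe_le_coe]
  push_cast
  nlinarith [sq_nonneg ((a : ℝ) - b)]

/-- Functions whose suprema are normalized: the additive form of the one-dimensional
Prékopa–Leindler inequality. -/
theorem lintegral_add_le_of_iSup_eq_one {f g h : ℝ → ℝ≥0∞} (hf : Measurable f) (hg : Measurable g)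
    (hh : Measurable h) (hf1 : ⨆ x, f x = 1) (hg1 : ⨆ x, g x = 1)
    (H : ∀ x y, f x * g y ≤ h ((x + y) / 2) ^ 2) :
    (∫⁻ x, f x) + (∫⁻ x, g x) ≤ 2 * ∫⁻ x, h x := by
  rw [lintegral_eq_lintegral_measure_ofReal_lt _ hf, lintegral_eq_lintegral_measure_ofReal_lt _ hg,
    lintegral_eq_lintegral_measure_ofReal_lt _ hh, ← lintegral_add_left, ← lintegral_const_mul]
  · refine setLIntegral_mono' measurableSet_Ioi fun t ht => ?_
    -- Because both suprema are exactly `1`, the superlevel sets of `f` and `g` are both nonempty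
    -- below level `1` and both empty from there on; Brunn–Minkowski needs nonempty sets.
    rcases lt_or_ge t 1 with h1 | h1
    · have ht1 : ENNReal.ofReal t < 1 := by simpa using h1
      refine volume_add_volume_le_of_midpoint (measurableSet_lt (by fun_prop) hf)
        (measurableSet_lt (by fun_prop) hg) ?_ ?_ ?_
      · exact lt_iSup_iff.1 (hf1 ▸ ht1)
      · exact lt_iSup_iff.1 (hg1 ▸ ht1)
      · intro x hx y hy
        by_contra hcon
        simp only [Set.mem_ofPred_eq, not_lt] at hx hy hcon
        have := (ENNReal.mul_lt_mul hx hy).trans_le ((H x y).trans (pow_le_pow_left' hcon 2))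
        rw [sq] at this
        exact lt_irrefl _ this
    · have e : ∀ {k : ℝ → ℝ≥0∞}, ⨆ x, k x = 1 → {x | ENNReal.ofReal t < k x} = ∅ := by
        intro k hk
        ext x
        simp only [Set.mem_ofPred_eq, Set.mem_empty_iff_false, iff_false, not_lt]
        exact (le_iSup k x).trans (hk.le.trans (by simpa using h1))
      simp [e hf1, e hg1]
  · exact (measurable_measure_prodMk_left (measurableSet_lt
      (f := fun p : ℝ × ℝ => ENNReal.ofReal p.1) (g := fun p => h p.2) (by fun_prop) (by fun_prop)))
  · exact (measurable_measure_prodMk_left (measurableSet_lt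
      (f := fun p : ℝ × ℝ => ENNReal.ofReal p.1) (g := fun p => f p.2) (by fun_prop) (by fun_prop)))

/-- The midpoint Prékopa–Leindler property of a measure. -/
def PrekopaLeindler {E : Type*} [AddCommGroup E] [Module ℝ E] [MeasurableSpace E]
    (μ : Measure E) : Prop :=
  ∀ f g h : E → ℝ≥0∞, Measurable f → Measurable g → Measurable h →
    (∀ x y, f x * g y ≤ h ((2⁻¹ : ℝ) • (x + y)) ^ 2) →
    (∫⁻ x, f x ∂μ) * (∫⁻ x, g x ∂μ) ≤ (∫⁻ x, h x ∂μ) ^ 2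

/-- For bounded functions, divide `f` and `g` by their suprema `a`, `b` and `h` by `√(ab)`; the
additive form followed by `4xy ≤ (x + y)²` is the claim. Truncation at integer heights removes
boundedness. -/
theorem prekopaLeindler_real : PrekopaLeindler (volume : Measure ℝ) := by
  have bdd : ∀ f g h : ℝ → ℝ≥0∞, Measurable f → Measurable g → Measurable h →
      (∀ x y, f x * g y ≤ h ((2⁻¹ : ℝ) • (x + y)) ^ 2) → ⨆ x, f x ≠ ⊤ → ⨆ x, g x ≠ ⊤ →
      (∫⁻ x, f x) * (∫⁻ x, g x) ≤ (∫⁻ x, h x) ^ 2 := by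
    intro f g h hf hg hh H hfb hgb
    set a := ⨆ x, f x with ha
    set b := ⨆ x, g x with hb
    rcases eq_or_ne a 0 with ha0 | ha0
    · have : f = 0 := by
        ext x; exact le_antisymm ((le_iSup f x).trans (ha.symm.trans ha0).le) bot_le
      simp [this]
    rcases eq_or_ne b 0 with hb0 | hb0
    · have : g = 0 := by
        ext x; exact le_antisymm ((le_iSup g x).trans (hb.symm.trans hb0).le) bot_le
      simp [this]
    obtain ⟨c, hc⟩ : ∃ c : ℝ≥0∞, c ^ 2 = a * b :=
      ⟨(a * b) ^ (2⁻¹ : ℝ), by rw [← ENNReal.rpow_natCast, ← ENNReal.rpow_mul]; simp⟩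
    have hab : a * b ≠ ⊤ := ENNReal.mul_ne_top hfb hgb
    have hab0 : a * b ≠ 0 := mul_ne_zero ha0 hb0
    have key := lintegral_add_le_of_iSup_eq_one (f := fun x => a⁻¹ * f x) (g := fun x => b⁻¹ * g x)
      (h := fun x => c⁻¹ * h x) (by fun_prop) (by fun_prop) (by fun_prop)
      (by rw [← ENNReal.mul_iSup, ← ha, ENNReal.inv_mul_cancel ha0 hfb])
      (by rw [← ENNReal.mul_iSup, ← hb, ENNReal.inv_mul_cancel hb0 hgb]) (by
        intro x y
        have h2 := H x y
        rw [smul_eq_mul, inv_mul_eq_div] at h2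
        calc a⁻¹ * f x * (b⁻¹ * g y) = (a⁻¹ * b⁻¹) * (f x * g y) := by ring
          _ ≤ (a⁻¹ * b⁻¹) * h ((x + y) / 2) ^ 2 := by gcongr
          _ = _ := by
            rw [← ENNReal.mul_inv (.inl ha0) (.inl hfb), ← hc, ENNReal.inv_pow, mul_pow])
    rw [lintegral_const_mul _ hf, lintegral_const_mul _ hg, lintegral_const_mul _ hh] at key
    have h4 := (ENNReal.four_mul_le_add_sq _ _).trans (pow_le_pow_left' key 2)
    have h5 : 4 * ((∫⁻ x, f x) * ∫⁻ x, g x) * (a * b)⁻¹ ≤ 4 * (∫⁻ x, h x) ^ 2 * (a * b)⁻¹ := by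
      calc _ = 4 * (a⁻¹ * (∫⁻ x, f x) * (b⁻¹ * ∫⁻ x, g x)) := by
            rw [ENNReal.mul_inv (.inl ha0) (.inl hfb)]; ring
        _ ≤ _ := h4
        _ = _ := by rw [← hc, ENNReal.inv_pow]; ring
    rw [ENNReal.mul_le_mul_iff_left (by simpa using hab) (by simpa using hab0)] at h5
    rwa [ENNReal.mul_le_mul_iff_right (by simp) (by simp)] at h5
  intro f g h hf hg hh H
  have lim : ∀ {f : ℝ → ℝ≥0∞}, Measurable f →
      ∫⁻ x, f x = ⨆ k : ℕ, ∫⁻ x, min (f x) k := by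
    intro f hf
    rw [← lintegral_iSup (fun k => by fun_prop)
      (fun k l hkl x => by dsimp only; gcongr)]
    refine lintegral_congr fun x => ?_
    change _ = ⨆ k : ℕ, f x ⊓ k
    rw [← inf_iSup_eq, ENNReal.iSup_natCast, inf_top_eq]
  rw [lim hf, lim hg, ENNReal.iSup_mul]
  refine iSup_le fun k => ?_
  rw [ENNReal.mul_iSup]
  refine iSup_le fun l => bdd _ _ h (by fun_prop) (by fun_prop) hh (fun x y => ?_) ?_ ?_
  · exact (mul_le_mul' (min_le_left _ _) (min_le_left _ _)).trans (H x y)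
  · exact ne_top_of_le_ne_top (ENNReal.natCast_ne_top k) (iSup_le fun x => min_le_right _ _)
  · exact ne_top_of_le_ne_top (ENNReal.natCast_ne_top l) (iSup_le fun x => min_le_right _ _)

/-- The inequality on fibres is exactly the hypothesis needed to apply it to the fibre integrals on
the base, so the property passes to products without loss. -/
theorem PrekopaLeindler.prod {E F : Type*} [AddCommGroup E] [Module ℝ E] [MeasurableSpace E]
    [AddCommGroup F] [Module ℝ F] [MeasurableSpace F] {μ : Measure E} {ν : Measure F}
    [SFinite μ] [SFinite ν] (hμ : PrekopaLeindler μ) (hν : PrekopaLeindler ν) :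
    PrekopaLeindler (μ.prod ν) := by
  intro f g h hf hg hh H
  rw [lintegral_prod _ hf.aemeasurable, lintegral_prod _ hg.aemeasurable,
    lintegral_prod _ hh.aemeasurable]
  refine hμ _ _ _ hf.lintegral_prod_right' hg.lintegral_prod_right' hh.lintegral_prod_right'
    fun x y => ?_
  exact hν _ _ _ (by fun_prop) (by fun_prop) (by fun_prop) fun s t => H (x, s) (y, t)

theorem PrekopaLeindler.map {E F : Type*} [AddCommGroup E] [Module ℝ E] [MeasurableSpace E]
    [AddCommGroup F] [Module ℝ F] [MeasurableSpace F] {μ : Measure E} {ν : Measure F}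
    (hμ : PrekopaLeindler μ) (e : E →ₗ[ℝ] F) (he : MeasurePreserving e μ ν) :
    PrekopaLeindler ν := by
  intro f g h hf hg hh H
  rw [← he.lintegral_comp hf, ← he.lintegral_comp hg, ← he.lintegral_comp hh]
  exact hμ _ _ _ (hf.comp he.measurable) (hg.comp he.measurable) (hh.comp he.measurable)
    fun x y => by simpa using H (e x) (e y)

theorem prekopaLeindler_pi (n : ℕ) : PrekopaLeindler (volume : Measure (Fin n → ℝ)) := by
  induction n with
  | zero =>
    intro f g h hf hg hh H
    have e : (volume : Measure (Fin 0 → ℝ)) = Measure.dirac 0 := Measure.pi_of_empty _ _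
    rw [e, lintegral_dirac, lintegral_dirac, lintegral_dirac]
    simpa using H 0 0
  | succ n ih =>
    refine (prekopaLeindler_real.prod ih).map
      { toFun := fun p => Fin.cons p.1 p.2
        map_add' := ?_
        map_smul' := ?_ } ?_
    · intro p q
      ext i
      refine Fin.cases ?_ (fun i => ?_) i <;> simp
    · intro c p
      ext i
      refine Fin.cases ?_ (fun i => ?_) i <;> simp
    · have := (volume_preserving_piFinSuccAbove (fun _ : Fin (n + 1) => ℝ) 0).symm
      have hfun : ⇑(MeasurableEquiv.piFinSuccAbove (fun _ : Fin (n + 1) => ℝ) 0).symm =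
          fun p => (Fin.cons p.1 p.2 : Fin (n + 1) → ℝ) :=
        funext fun p => Fin.insertNth_zero' p.1 p.2
      rw [hfun] at this
      exact this

theorem prekopaLeindler_euclideanSpace (n : ℕ) :
    PrekopaLeindler (volume : Measure (EuclideanSpace ℝ (Fin n))) :=
  (prekopaLeindler_pi n).map (WithLp.linearEquiv 2 ℝ (Fin n → ℝ)).symm.toLinearMap
    (PiLp.volume_preserving_toLp (Fin n))

/-! ### Concentration of measure on the sphere. -/

theorem volume_image_preimage_homeomorphUnitSphereProd {E : Type*} [NormedAddCommGroup E]
    [NormedSpace ℝ E] [FiniteDimensional ℝ E] [MeasurableSpace E] [BorelSpace E]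
    (μ : Measure E) [μ.IsAddHaarMeasure] (A : Set (Metric.sphere (0 : E) 1))
    (T : Set (Set.Ioi (0 : ℝ))) (hA : MeasurableSet A) (hT : MeasurableSet T) :
    μ ((↑) '' (homeomorphUnitSphereProd E ⁻¹' A ×ˢ T)) =
      μ.toSphere A * Measure.volumeIoiPow (Module.finrank ℝ E - 1) T := by
  rw [← Measure.prod_prod, ← μ.measurePreserving_homeomorphUnitSphereProd.measure_preimage
    (hA.prod hT).nullMeasurableSet, comap_subtype_coe_apply (measurableSet_singleton _).compl]

section Concentration

variable {N : ℕ}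

local notation "𝔼" => EuclideanSpace ℝ (Fin N)

/-- Uniform convexity: `‖sa + tb‖² = (s + t)² - st‖a - b‖²` with `st ≥ 1/4`, then `1 - y ≤ exp
(-y)`. Keeping `s` and `t` away from `0` is what yields a gain. -/
theorem norm_midpoint_le_of_le_dist {E : Type*} [NormedAddCommGroup E] [InnerProductSpace ℝ E]
    {a b : E} (ha : ‖a‖ = 1) (hb : ‖b‖ = 1) {ρ s t : ℝ} (hρ : 0 ≤ ρ) (h : ρ ≤ ‖a - b‖)
    (hs : 1 / 2 ≤ s) (hs1 : s ≤ 1) (ht : 1 / 2 ≤ t) (ht1 : t ≤ 1) :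
    ‖(2⁻¹ : ℝ) • (s • a + t • b)‖ ≤ Real.exp (-(ρ ^ 2 / 32)) := by
  have h1 : ‖a - b‖ ^ 2 = 2 - 2 * inner ℝ a b := by
    rw [norm_sub_sq_real, ha, hb]; ring
  have h2 : ‖(2⁻¹ : ℝ) • (s • a + t • b)‖ ^ 2 = (s ^ 2 + 2 * s * t * inner ℝ a b + t ^ 2) / 4 := by
    rw [norm_smul, mul_pow, norm_add_sq_real, norm_smul, norm_smul, inner_smul_left,
      inner_smul_right, ha, hb]
    simp
    ring
  have h3 : ρ ^ 2 ≤ 2 - 2 * inner ℝ a b := by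
    rw [← h1]; gcongr
  have h4 : ‖(2⁻¹ : ℝ) • (s • a + t • b)‖ ^ 2 ≤ 1 - ρ ^ 2 / 16 := by
    rw [h2]
    have hst : 1 / 4 ≤ s * t := by nlinarith
    have := mul_le_mul hst h3 (by positivity) (by positivity)
    nlinarith
  have h5 : ‖(2⁻¹ : ℝ) • (s • a + t • b)‖ ^ 2 ≤ Real.exp (-(ρ ^ 2 / 32)) ^ 2 := by
    rw [← Real.exp_nat_mul]
    have := Real.add_one_le_exp (((2 : ℕ) : ℝ) * -(ρ ^ 2 / 32))
    push_cast at this ⊢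
    linarith
  exact le_of_sq_le_sq h5 (by positivity)

/-- Apply Prékopa–Leindler to the indicators of the cones over `A` and `B` with radii in `[1/2, 1)`
and of the small ball containing their midpoints; the volume of that ball carries the factor `exp
(-Nρ²/32)`, which gets squared. -/
theorem unifSphere_mul_le_of_le_dist (hN : 0 < N) {A B : Set (Metric.sphere (0 : 𝔼) 1)}
    (hA : MeasurableSet A) (hB : MeasurableSet B) {ρ : ℝ} (hρ : 0 ≤ ρ)
    (h : ∀ a ∈ A, ∀ b ∈ B, ρ ≤ ‖(a : 𝔼) - b‖) :
    unifSphere N A * unifSphere N B ≤ ENNReal.ofReal (4 * Real.exp (-(N * ρ ^ 2 / 16))) := by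
  have : Nonempty (Fin N) := ⟨⟨0, hN⟩⟩
  set σ := (volume : Measure 𝔼).toSphere with hσ
  let u : Set.Ioi (0 : ℝ) := ⟨1, Set.mem_Ioi.2 one_pos⟩
  let w : Set.Ioi (0 : ℝ) := ⟨1 / 2, Set.mem_Ioi.2 one_half_pos⟩
  let T : Set (Set.Ioi (0 : ℝ)) := Set.Iio u \ Set.Iio w
  have hT : MeasurableSet T := measurableSet_Iio.diff measurableSet_Iio
  have hsec : ∀ A : Set (Metric.sphere (0 : 𝔼) 1), MeasurableSet A → MeasurableSet
      ((↑) '' (homeomorphUnitSphereProd 𝔼 ⁻¹' A ×ˢ T) : Set 𝔼) := fun A hA =>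
    (MeasurableEmbedding.subtype_coe (measurableSet_singleton _).compl).measurableSet_image.2
      ((homeomorphUnitSphereProd 𝔼).measurable (hA.prod hT))
  have hmem : ∀ (A : Set (Metric.sphere (0 : 𝔼) 1)) (x : 𝔼),
      x ∈ ((↑) '' (homeomorphUnitSphereProd 𝔼 ⁻¹' A ×ˢ T) : Set 𝔼) →
      ∃ a ∈ A, ∃ s : ℝ, 1 / 2 ≤ s ∧ s ≤ 1 ∧ x = s • (a : 𝔼) := by
    rintro A x ⟨y, ⟨hy1, hy2⟩, rfl⟩
    refine ⟨_, hy1, (homeomorphUnitSphereProd 𝔼 y).2, ?_, ?_, ?_⟩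
    · exact not_lt.1 fun h => hy2.2 h
    · have h1 : (homeomorphUnitSphereProd 𝔼 y).2 < u := hy2.1
      exact le_of_lt (Subtype.coe_lt_coe.2 h1)
    · have : ‖(y : 𝔼)‖ ≠ 0 := norm_ne_zero_iff.2 y.2
      simp [smul_smul, this]
  have hPL := prekopaLeindler_euclideanSpace N _ _
    ((Metric.closedBall (0 : 𝔼) (Real.exp (-(ρ ^ 2 / 32)))).indicator 1)
    (measurable_one.indicator (hsec A hA)) (measurable_one.indicator (hsec B hB))
    (measurable_one.indicator measurableSet_closedBall) (by
      intro x y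
      by_cases hx : x ∈ ((↑) '' (homeomorphUnitSphereProd 𝔼 ⁻¹' A ×ˢ T) : Set 𝔼)
      · by_cases hy : y ∈ ((↑) '' (homeomorphUnitSphereProd 𝔼 ⁻¹' B ×ˢ T) : Set 𝔼)
        · obtain ⟨a, ha, s, hs, hs1, rfl⟩ := hmem A x hx
          obtain ⟨b, hb, t, ht, ht1, rfl⟩ := hmem B y hy
          have := norm_midpoint_le_of_le_dist (norm_eq_of_mem_sphere a) (norm_eq_of_mem_sphere b)
            hρ (h a ha b hb) hs hs1 ht ht1
          rw [Set.indicator_of_mem hx, Set.indicator_of_mem hy, Set.indicator_of_mem (by simpa)]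
          simp
        · rw [Set.indicator_of_notMem hy]; simp
      · rw [Set.indicator_of_notMem hx]; simp)
  rw [lintegral_indicator_one (hsec A hA), lintegral_indicator_one (hsec B hB),
    lintegral_indicator_one measurableSet_closedBall,
    volume_image_preimage_homeomorphUnitSphereProd _ A T hA hT,
    volume_image_preimage_homeomorphUnitSphereProd _ B T hB hT,
    Measure.addHaar_closedBall _ _ (by positivity), ← hσ] at hPL
  have hfr : Module.finrank ℝ 𝔼 = N := by simp
  have hNR : (0 : ℝ) < N := by exact_mod_cast hN
  -- The radial mass of the shell is `(1 - 2⁻ᴺ)/N`, at least half that of the full ball; losing this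
  -- half twice produces the constant `4`.
  have hTm : ENNReal.ofReal (1 / (2 * N)) ≤ Measure.volumeIoiPow (Module.finrank ℝ 𝔼 - 1) T := by
    have hwu : w ≤ u := Subtype.coe_le_coe.1 one_half_lt_one.le
    rw [measure_sdiff (Set.Iio_subset_Iio hwu) measurableSet_Iio.nullMeasurableSet
        (by rw [Measure.volumeIoiPow_apply_Iio]; exact ENNReal.ofReal_ne_top),
      Measure.volumeIoiPow_apply_Iio, Measure.volumeIoiPow_apply_Iio, hfr,
      ← ENNReal.ofReal_sub _ (by positivity)]
    refine ENNReal.ofReal_le_ofReal ?_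
    rw [← Nat.cast_succ, Nat.succ_eq_add_one, Nat.sub_add_cancel hN]
    have : (1 / 2 : ℝ) ^ N ≤ 1 / 2 := pow_le_of_le_one (by norm_num) (by norm_num) hN.ne'
    have hu : (u : ℝ) = 1 := rfl
    have hw : (w : ℝ) = 1 / 2 := rfl
    rw [hu, hw, one_pow, ← sub_div, div_le_div_iff₀ (by positivity) hNR]
    nlinarith
  have huniv : σ Set.univ = N * volume (Metric.ball (0 : 𝔼) 1) := by
    rw [hσ, Measure.toSphere_apply_univ, hfr]
  set v := volume (Metric.ball (0 : 𝔼) 1) with hv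
  have hv0 : v ≠ 0 := (Metric.measure_ball_pos _ _ one_pos).ne'
  have hvt : v ≠ ⊤ := measure_ball_lt_top.ne
  have hσ0 : σ Set.univ ≠ 0 := by
    rw [huniv]; exact mul_ne_zero (by exact_mod_cast hN.ne') hv0
  have hσt : σ Set.univ ≠ ⊤ := measure_ne_top _ _
  have hA' : unifSphere N A = (σ Set.univ)⁻¹ * σ A := rfl
  have hB' : unifSphere N B = (σ Set.univ)⁻¹ * σ B := rfl
  have h1 : σ A * ENNReal.ofReal (1 / (2 * N)) * (σ B * ENNReal.ofReal (1 / (2 * N))) ≤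
      (ENNReal.ofReal (Real.exp (-(ρ ^ 2 / 32)) ^ N) * v) ^ 2 := by
    rw [hfr] at hPL hTm
    exact le_trans (by gcongr) hPL
  have hcN : ENNReal.ofReal (1 / (2 * N)) = (2 * (N : ℝ≥0∞))⁻¹ := by
    rw [one_div, ENNReal.ofReal_inv_of_pos (by positivity), ENNReal.ofReal_mul (by norm_num)]
    simp
  have hexp : ENNReal.ofReal (4 * Real.exp (-(N * ρ ^ 2 / 16))) =
      4 * ENNReal.ofReal (Real.exp (-(ρ ^ 2 / 32)) ^ N) ^ 2 := by
    rw [ENNReal.ofReal_mul (by norm_num), ← ENNReal.ofReal_pow (by positivity), ← pow_mul,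
      ← Real.exp_nat_mul]
    simp only [ENNReal.ofReal_ofNat]
    congr 3
    push_cast
    ring
  rw [hexp, hA', hB']
  set e := ENNReal.ofReal (Real.exp (-(ρ ^ 2 / 32)) ^ N)
  rw [hcN] at h1
  have hN0 : (2 * (N : ℝ≥0∞)) ≠ 0 := by simp [hN.ne']
  have hNt : (2 * (N : ℝ≥0∞)) ≠ ⊤ := ENNReal.mul_ne_top (by simp) (by simp)
  have hc : (2 * (N : ℝ≥0∞)) * (2 * (N : ℝ≥0∞))⁻¹ = 1 := ENNReal.mul_inv_cancel hN0 hNt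
  have hvv : v * v⁻¹ = 1 := ENNReal.mul_inv_cancel hv0 hvt
  have hNN : (N : ℝ≥0∞) * (N : ℝ≥0∞)⁻¹ = 1 :=
    ENNReal.mul_inv_cancel (by simp [hN.ne']) (by simp)
  rw [huniv, ENNReal.mul_inv (.inr hvt) (.inr hv0)]
  calc (N : ℝ≥0∞)⁻¹ * v⁻¹ * σ A * ((N : ℝ≥0∞)⁻¹ * v⁻¹ * σ B)
      = ((N : ℝ≥0∞)⁻¹ * v⁻¹) ^ 2 * (σ A * ((2 * (N : ℝ≥0∞)) * (2 * (N : ℝ≥0∞))⁻¹) *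
        (σ B * ((2 * (N : ℝ≥0∞)) * (2 * (N : ℝ≥0∞))⁻¹))) := by rw [hc]; ring
    _ = ((N : ℝ≥0∞)⁻¹ * v⁻¹) ^ 2 * (2 * (N : ℝ≥0∞)) ^ 2 *
        (σ A * (2 * (N : ℝ≥0∞))⁻¹ * (σ B * (2 * (N : ℝ≥0∞))⁻¹)) := by ring
    _ ≤ ((N : ℝ≥0∞)⁻¹ * v⁻¹) ^ 2 * (2 * (N : ℝ≥0∞)) ^ 2 * (e * v) ^ 2 := by gcongr
    _ = 4 * e ^ 2 * ((N : ℝ≥0∞) * (N : ℝ≥0∞)⁻¹) ^ 2 * (v * v⁻¹) ^ 2 := by ring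
    _ = 4 * e ^ 2 := by rw [hvv, hNN]; ring

theorem isProbabilityMeasure_unifSphere (hN : 0 < N) : IsProbabilityMeasure (unifSphere N) := by
  have : Nonempty (Fin N) := ⟨⟨0, hN⟩⟩
  have : Nontrivial 𝔼 := inferInstance
  constructor
  rw [unifSphere, Measure.smul_apply, smul_eq_mul, ENNReal.inv_mul_cancel]
  · exact mt Measure.measure_univ_eq_zero.1 (Measure.toSphere_ne_zero (volume : Measure 𝔼))
  · exact measure_ne_top _ _

/-- Concentration of measure on the sphere, around a median. -/
theorem unifSphere_abs_sub_median_gt_le (hN : 0 < N) {F : Metric.sphere (0 : 𝔼) 1 → ℝ} {L M r : ℝ}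
    (hL : 0 < L) (hF : ∀ a b, F a - F b ≤ L * ‖(a : 𝔼) - b‖) (hM : IsMedian (unifSphere N) F M)
    (hr : 0 ≤ r) :
    (unifSphere N).real {a | r < |F a - M|} ≤ 2 * Real.exp (-(N * r ^ 2 / (64 * L ^ 2))) := by
  have := isProbabilityMeasure_unifSphere hN
  have hFc : Continuous F := by
    have : LipschitzWith L.toNNReal F := LipschitzWith.of_le_add_mul _ fun a b => by
      have := hF a b
      rw [Subtype.dist_eq, dist_eq_norm]
      rw [Real.coe_toNNReal L hL.le]
      linarith
    exact this.continuous
  have hFm := hFc.measurable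
  have key : ∀ A B : Set (Metric.sphere (0 : 𝔼) 1), MeasurableSet A → MeasurableSet B →
      1 / 2 ≤ unifSphere N A → (∀ a ∈ A, ∀ b ∈ B, r / L ≤ ‖(a : 𝔼) - b‖) →
      (unifSphere N).real B ≤ 8 * Real.exp (-(N * r ^ 2 / (16 * L ^ 2))) := by
    intro A B hA hB hA2 hAB
    have h1 := unifSphere_mul_le_of_le_dist hN hA hB (by positivity) hAB
    have h2 : 1 / 2 * unifSphere N B ≤ ENNReal.ofReal (4 * Real.exp (-(N * (r / L) ^ 2 / 16))) :=
      le_trans (by gcongr) h1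
    have h3 := ENNReal.toReal_mono ENNReal.ofReal_ne_top h2
    rw [ENNReal.toReal_mul, ENNReal.toReal_ofReal (by positivity)] at h3
    have e : (N * (r / L) ^ 2 / 16 : ℝ) = N * r ^ 2 / (16 * L ^ 2) := by field_simp
    rw [e] at h3
    simp only [one_div, ENNReal.toReal_inv, ENNReal.toReal_ofNat] at h3
    rw [measureReal_def]
    linarith
  have hup := key {a | F a ≤ M} {a | M + r < F a} (measurableSet_le hFm measurable_const)
    (measurableSet_lt measurable_const hFm) hM.2 (by
      intro a ha b hb
      rw [div_le_iff₀ hL, norm_sub_rev, mul_comm]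
      simp only [Set.mem_ofPred_eq] at ha hb
      linarith [hF b a])
  have hdn := key {a | M ≤ F a} {a | F a < M - r} (measurableSet_le measurable_const hFm)
    (measurableSet_lt hFm measurable_const) hM.1 (by
      intro a ha b hb
      rw [div_le_iff₀ hL, mul_comm]
      simp only [Set.mem_ofPred_eq] at ha hb
      linarith [hF a b])
  set p := (unifSphere N).real {a | r < |F a - M|} with hp
  have hp0 : 0 ≤ p := measureReal_nonneg
  have hp1 : p ≤ 1 := measureReal_le_one
  have hp16 : p ≤ 16 * Real.exp (-(N * r ^ 2 / (16 * L ^ 2))) := by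
    have hsub : {a | r < |F a - M|} ⊆ {a | M + r < F a} ∪ {a | F a < M - r} := by
      intro a ha
      simp only [Set.mem_ofPred_eq, lt_abs] at ha
      rcases ha with ha | ha
      · left; simp only [Set.mem_ofPred_eq]; linarith
      · right; simp only [Set.mem_ofPred_eq]; linarith
    have := (measureReal_mono (μ := unifSphere N) hsub (measure_ne_top _ _)).trans
      (measureReal_union_le _ _)
    linarith
  -- Since `p ≤ 1`, `p⁴ ≤ p ≤ 16 exp (-x)`, and a fourth root trades the prefactor `16` for `2` at
  -- the cost of a quarter of the exponent.
  refine le_of_pow_le_pow_left₀ (n := 4) (by norm_num) (by positivity) ?_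
  have h4 : p ^ 4 ≤ p := pow_le_of_le_one hp0 hp1 (by norm_num)
  refine h4.trans (hp16.trans_eq ?_)
  rw [mul_pow, ← Real.exp_nat_mul]
  congr 1
  · norm_num
  · congr 1
    push_cast
    field_simp
    ring

end Concentration

/-! ### Existence of medians. -/

/-- The median is the infimum of the levels where the distribution function reaches `1/2`: right
continuity gives one inequality, continuity of the measure along levels increasing to it the other.
-/
theorem exists_isMedian {Ω : Type*} [MeasurableSpace Ω] (μ : Measure Ω) [IsProbabilityMeasure μ]
    {F : Ω → ℝ} (hF : Measurable F) : ∃ M, IsMedian μ F M := by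
  have := Measure.isProbabilityMeasure_map (μ := μ) hF.aemeasurable
  set c := ProbabilityTheory.cdf (μ.map F) with hc
  have hcv : ∀ t, c t = μ.real {x | F x ≤ t} := by
    intro t
    rw [hc, ProbabilityTheory.cdf_eq_real, map_measureReal_apply hF measurableSet_Iic]
    rfl
  set T := {t | 1 / 2 ≤ c t} with hT
  have hTn : T.Nonempty := by
    have := (ProbabilityTheory.tendsto_cdf_atTop (μ.map F)).eventually
      (eventually_ge_nhds (show (1 / 2 : ℝ) < 1 by norm_num))
    exact this.exists
  have hTb : BddBelow T := by
    obtain ⟨b, hb⟩ := ((ProbabilityTheory.tendsto_cdf_atBot (μ.map F)).eventually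
      (eventually_lt_nhds (show (0 : ℝ) < 1 / 2 by norm_num))).exists
    refine ⟨b, fun t ht => ?_⟩
    by_contra hlt
    exact absurd ((ht : 1 / 2 ≤ c t).trans (c.mono (not_le.1 hlt).le)) (not_le.2 hb)
  have hgt : ∀ t, sInf T < t → 1 / 2 ≤ c t := by
    intro t ht
    obtain ⟨s, hs, hst⟩ := exists_lt_of_csInf_lt hTn ht
    exact (hs : 1 / 2 ≤ c s).trans (c.mono hst.le)
  have hlt : ∀ t, t < sInf T → c t < 1 / 2 := by
    intro t ht
    by_contra h
    exact absurd (csInf_le hTb (not_lt.1 h)) (not_le.2 ht)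
  refine ⟨sInf T, ?_, ?_⟩
  · have hlim : Tendsto (fun n : ℕ => μ {x | F x ≤ sInf T - 1 / (n + 1)}) atTop
        (𝓝 (μ (⋃ n : ℕ, {x | F x ≤ sInf T - 1 / (n + 1)}))) := by
      refine tendsto_measure_iUnion_atTop fun m n hmn x hx => ?_
      simp only [Set.mem_ofPred_eq] at hx ⊢
      have : 1 / ((n : ℝ) + 1) ≤ 1 / (m + 1) := by gcongr
      exact le_trans hx (by linarith)
    have hle : μ {x | F x < sInf T} ≤ 1 / 2 := by
      have hU : (⋃ n : ℕ, {x | F x ≤ sInf T - 1 / (n + 1)}) = {x | F x < sInf T} := by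
        ext x
        simp only [Set.mem_iUnion, Set.mem_ofPred_eq]
        constructor
        · rintro ⟨n, hn⟩
          have : 0 < 1 / ((n : ℝ) + 1) := by positivity
          linarith
        · intro hx
          obtain ⟨n, hn⟩ := exists_nat_one_div_lt (sub_pos.2 hx)
          exact ⟨n, by linarith⟩
      rw [hU] at hlim
      refine le_of_tendsto' hlim fun n => ?_
      have h1 := hlt (sInf T - 1 / (n + 1)) (by
        have : 0 < 1 / ((n : ℝ) + 1) := by positivity
        linarith)
      rw [hcv] at h1
      rw [← ofReal_measureReal]
      refine (ENNReal.ofReal_le_ofReal h1.le).trans ?_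
      rw [ENNReal.ofReal_div_of_pos two_pos]
      simp
    have hcompl : {x | sInf T ≤ F x} = {x | F x < sInf T}ᶜ := by
      ext x; simp
    rw [hcompl, prob_compl_eq_one_sub (measurableSet_lt hF measurable_const)]
    calc (1 / 2 : ℝ≥0∞) = 1 - 1 / 2 := by simp
      _ ≤ _ := by gcongr
  · have h1 : 1 / 2 ≤ c (sInf T) := by
      have := (c.right_continuous (sInf T)).mono Set.Ioi_subset_Ici_self
      refine ge_of_tendsto this ?_
      filter_upwards [self_mem_nhdsWithin] with t ht using hgt t ht
    rw [hcv] at h1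
    have := ENNReal.ofReal_le_ofReal h1
    rw [ofReal_measureReal, ENNReal.ofReal_div_of_pos two_pos] at this
    simpa using this

/-! ### Isometries of the sphere and Haar measure on the orthogonal group. -/

section SphereIsometry

variable {E : Type*} [NormedAddCommGroup E] [InnerProductSpace ℝ E]

/-- The action of a linear isometric automorphism on the unit sphere. -/
def sphereMap (e : E ≃ₗᵢ[ℝ] E) (x : Metric.sphere (0 : E) 1) : Metric.sphere (0 : E) 1 :=
  ⟨e x, by simp⟩

@[simp] theorem coe_sphereMap (e : E ≃ₗᵢ[ℝ] E) (x : Metric.sphere (0 : E) 1) :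
    (sphereMap e x : E) = e x := rfl

theorem continuous_sphereMap (e : E ≃ₗᵢ[ℝ] E) : Continuous (sphereMap e) :=
  Continuous.subtype_mk (e.continuous.comp continuous_subtype_val) _

variable [FiniteDimensional ℝ E]

theorem exists_sphereMap_eq (x y : Metric.sphere (0 : E) 1) :
    ∃ e : E ≃ₗᵢ[ℝ] E, sphereMap e x = y := by
  have hpos : 0 < Module.finrank ℝ E := by
    have : Nontrivial E := ⟨⟨x, 0, fun h => by
      have := norm_eq_of_mem_sphere x
      rw [h, norm_zero] at this
      exact zero_ne_one this⟩⟩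
    exact Module.finrank_pos
  have ext : ∀ z : Metric.sphere (0 : E) 1,
      ∃ b : OrthonormalBasis (Fin (Module.finrank ℝ E)) ℝ E, b ⟨0, hpos⟩ = z := by
    intro z
    obtain ⟨b, hb⟩ := Orthonormal.exists_orthonormalBasis_extension_of_card_eq (𝕜 := ℝ)
      (ι := Fin (Module.finrank ℝ E)) (by simp) (v := fun _ => (z : E)) (s := {⟨0, hpos⟩}) (by
        rw [orthonormal_iff_ite]
        rintro ⟨i, rfl⟩ ⟨j, rfl⟩
        simp)
    exact ⟨b, hb _ rfl⟩
  obtain ⟨b, hb⟩ := ext x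
  obtain ⟨b', hb'⟩ := ext y
  refine ⟨b.equiv b' (Equiv.refl _), Subtype.ext ?_⟩
  rw [coe_sphereMap, ← hb, OrthonormalBasis.equiv_apply_basis, Equiv.refl_apply, hb']

variable [MeasurableSpace E] [BorelSpace E]

-- The surface measure of a set is defined through the volume of the cone over it, and a linear
-- isometry carries cones to cones and preserves volume.
open scoped Pointwise in
theorem measurePreserving_sphereMap (e : E ≃ₗᵢ[ℝ] E) :
    MeasurePreserving (sphereMap e) (volume : Measure E).toSphere
      (volume : Measure E).toSphere := by
  refine ⟨(continuous_sphereMap e).measurable, ?_⟩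
  ext A hA
  rw [Measure.map_apply (continuous_sphereMap e).measurable hA, Measure.toSphere_apply' _ hA,
    Measure.toSphere_apply' _ ((continuous_sphereMap e).measurable hA)]
  congr 1
  rw [← (show MeasurePreserving e.toMeasurableEquiv volume volume from
    LinearIsometryEquiv.measurePreserving e).measure_preimage_equiv
      (Set.Ioo (0 : ℝ) 1 • ((↑) '' A : Set E))]
  congr 1
  ext x
  simp only [Set.mem_smul, Set.mem_image, Set.mem_preimage, exists_exists_and_eq_and]
  constructor
  · rintro ⟨r, hr, a, ha, rfl⟩
    exact ⟨r, hr, _, ha, by simp⟩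
  · rintro ⟨r, hr, a, ha, h⟩
    refine ⟨r, hr, sphereMap e.symm a, ?_, ?_⟩
    · have : sphereMap e (sphereMap e.symm a) = a := by ext1; simp
      rwa [this]
    · apply e.injective
      simpa using h

end SphereIsometry

theorem haarO_isProbabilityMeasure (N : ℕ) : IsProbabilityMeasure (haarO N) :=
  ⟨Measure.haarMeasure_self⟩

/-- A right translate of Haar measure is again a left-invariant probability measure, so uniqueness
identifies it with Haar measure. -/
theorem map_mul_right_haarO {N : ℕ} (V : OGroup N) : (haarO N).map (· * V) = haarO N := by
  have : IsProbabilityMeasure (haarO N) := haarO_isProbabilityMeasure N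
  have : (haarO N).IsHaarMeasure := by unfold haarO; infer_instance
  have h2 : IsProbabilityMeasure ((haarO N).map (· * V)) :=
    Measure.isProbabilityMeasure_map (by fun_prop)
  exact Measure.isHaarMeasure_eq_of_isProbabilityMeasure _ _

section Act

variable {N : ℕ}

local notation "𝔼" => EuclideanSpace ℝ (Fin N)

/-- An orthogonal matrix as a linear isometric automorphism. -/
noncomputable def OGroup.isometry (U : OGroup N) : 𝔼 ≃ₗᵢ[ℝ] 𝔼 :=
  LinearIsometry.toLinearIsometryEquiv
    { toLinearMap := Matrix.toEuclideanLin (U : Matrix (Fin N) (Fin N) ℝ)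
      norm_map' := fun x => by
        have h : (U : Matrix (Fin N) (Fin N) ℝ).transpose * U = 1 :=
          (Matrix.mem_orthogonalGroup_iff' _ _).1 U.2
        have h2 : ‖Matrix.toEuclideanLin (U : Matrix (Fin N) (Fin N) ℝ) x‖ ^ 2 = ‖x‖ ^ 2 := by
          rw [← real_inner_self_eq_norm_sq, ← real_inner_self_eq_norm_sq]
          simp only [EuclideanSpace.inner_eq_star_dotProduct, Matrix.toLpLin_apply, star_trivial]
          rw [Matrix.dotProduct_mulVec, Matrix.vecMul_mulVec, h, Matrix.vecMul_one]
        exact (sq_eq_sq₀ (norm_nonneg _) (norm_nonneg _)).1 h2 } rfl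

theorem OGroup.isometry_apply (U : OGroup N) (x : 𝔼) :
    U.isometry x = WithLp.toLp 2 ((U : Matrix (Fin N) (Fin N) ℝ).mulVec x.ofLp) := rfl

theorem OGroup.isometry_mul (U V : OGroup N) (x : 𝔼) :
    (U * V).isometry x = U.isometry (V.isometry x) := by
  simp [OGroup.isometry_apply, Matrix.mulVec_mulVec]

theorem OGroup.isometry_single (U : OGroup N) (k : Fin N) :
    U.isometry (EuclideanSpace.single k 1) =
      WithLp.toLp 2 fun i => (U : Matrix (Fin N) (Fin N) ℝ) i k := by
  rw [OGroup.isometry_apply]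
  congr 1
  ext i
  simp [Matrix.mulVec_single]

theorem OGroup.exists_isometry_eq (e : 𝔼 ≃ₗᵢ[ℝ] 𝔼) : ∃ U : OGroup N, U.isometry = e := by
  let b := (EuclideanSpace.basisFun (Fin N) ℝ)
  refine ⟨⟨b.toBasis.toMatrix (b.map e),
    b.toMatrix_orthonormalBasis_mem_orthogonal (b.map e)⟩, ?_⟩
  refine LinearIsometryEquiv.toLinearEquiv_injective
    (LinearEquiv.toLinearMap_injective (b.toBasis.ext fun k => ?_))
  have := OGroup.isometry_single ⟨b.toBasis.toMatrix (b.map e),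
    b.toMatrix_orthonormalBasis_mem_orthogonal (b.map e)⟩ k
  simpa [b, Module.Basis.toMatrix_apply] using this

theorem continuous_sphereMap_isometry :
    Continuous fun p : OGroup N × Metric.sphere (0 : 𝔼) 1 => sphereMap p.1.isometry p.2 := by
  refine Continuous.subtype_mk ?_ _
  change Continuous fun p : OGroup N × Metric.sphere (0 : 𝔼) 1 =>
    WithLp.toLp 2 ((p.1 : Matrix (Fin N) (Fin N) ℝ).mulVec (p.2 : 𝔼).ofLp)
  fun_prop

theorem measurePreserving_unifSphere (e : 𝔼 ≃ₗᵢ[ℝ] 𝔼) :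
    MeasurePreserving (sphereMap e) (unifSphere N) (unifSphere N) :=
  (measurePreserving_sphereMap e).smul_measure _

/-- The orbit map of a point under a Haar distributed orthogonal matrix is uniform on the sphere. -/
theorem haarO_sphereMap_mem (hN : 0 < N) (x : Metric.sphere (0 : 𝔼) 1)
    {B : Set (Metric.sphere (0 : 𝔼) 1)} (hB : MeasurableSet B) :
    haarO N {U | sphereMap U.isometry x ∈ B} = unifSphere N B := by
  have := isProbabilityMeasure_unifSphere hN
  have := haarO_isProbabilityMeasure N
  have hm := continuous_sphereMap_isometry (N := N) |>.measurable
  have hmx : ∀ x, Measurable fun U : OGroup N => sphereMap U.isometry x :=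
    fun x => (continuous_sphereMap_isometry.comp (Continuous.prodMk_left x)).measurable
  -- Transitivity on the sphere and right invariance make the law of the orbit independent of the
  -- starting point. Averaging over a uniform starting point and exchanging integrals then replaces
  -- the Haar integral by rotations of the uniform measure.
  have hconst : ∀ y, haarO N {U | sphereMap U.isometry y ∈ B} =
      haarO N {U | sphereMap U.isometry x ∈ B} := by
    intro y
    obtain ⟨e, he⟩ := exists_sphereMap_eq x y
    obtain ⟨V, rfl⟩ := OGroup.exists_isometry_eq e
    conv_rhs => rw [← map_mul_right_haarO V]
    have hS : MeasurableSet {U : OGroup N | sphereMap U.isometry x ∈ B} := hmx x hB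
    rw [Measure.map_apply (continuous_mul_const V).measurable hS]
    congr 1
    ext U
    have : sphereMap (U * V).isometry x = sphereMap U.isometry y := by
      rw [← he]; ext1; simp [OGroup.isometry_mul]
    simp [this]
  have h1 : ∫⁻ y, haarO N {U | sphereMap U.isometry y ∈ B} ∂unifSphere N =
      haarO N {U | sphereMap U.isometry x ∈ B} := by
    simp [hconst]
  have h2 : ∫⁻ y, haarO N {U | sphereMap U.isometry y ∈ B} ∂unifSphere N =
      ∫⁻ U, unifSphere N {y | sphereMap U.isometry y ∈ B} ∂haarO N := by
    have e1 := Measure.prod_apply (μ := haarO N) (ν := unifSphere N) (hm hB)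
    rw [Measure.prod_apply_symm (hm hB)] at e1
    exact e1
  rw [← h1, h2]
  have h3 : ∀ U : OGroup N, unifSphere N {y | sphereMap U.isometry y ∈ B} = unifSphere N B :=
    fun U => (measurePreserving_unifSphere U.isometry).measure_preimage hB.nullMeasurableSet
  simp [h3]

end Act

/-! ### Moments of sub-Gaussian variables. -/

section Moment

/-- A crude Stirling bound: `y ≤ exp y` at `y = t/(2x)` gives `t^x ≤ (2x)^x exp (t/2)`, and half of
the exponential remains to be integrated. -/
theorem Real.Gamma_add_one_le {x : ℝ} (hx : 0 < x) : Real.Gamma (x + 1) ≤ 2 * (2 * x) ^ x := by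
  rw [Real.Gamma_eq_integral (by linarith)]
  have hint : ∫ t in Set.Ioi (0 : ℝ), (2 * x) ^ x * Real.exp (-(1 / 2) * t) = 2 * (2 * x) ^ x := by
    rw [integral_const_mul, integral_exp_mul_Ioi (by norm_num)]
    simp
    ring
  rw [← hint]
  refine setIntegral_mono_on (Real.GammaIntegral_convergent (by linarith))
    ((integrableOn_exp_mul_Ioi (by norm_num) 0).const_mul _) measurableSet_Ioi fun t ht => ?_
  have ht : 0 < t := ht
  have h1 : t / (2 * x) ≤ Real.exp (t / (2 * x)) := by
    linarith [Real.add_one_le_exp (t / (2 * x))]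
  have h2 : (t / (2 * x)) ^ x ≤ Real.exp (t / 2) := by
    refine (Real.rpow_le_rpow (by positivity) h1 hx.le).trans_eq ?_
    rw [← Real.exp_mul]
    congr 1
    field_simp
  rw [Real.div_rpow ht.le (by positivity), div_le_iff₀ (by positivity)] at h2
  have h3 : Real.exp (-t) = Real.exp (-(1 / 2) * t) * Real.exp (-(1 / 2) * t) := by
    rw [← Real.exp_add]; congr 1; ring
  have h4 : Real.exp (t / 2) * Real.exp (-(1 / 2) * t) = 1 := by
    rw [← Real.exp_add]; ring_nf; exact Real.exp_zero
  rw [add_sub_cancel_right, h3]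
  calc Real.exp (-(1 / 2) * t) * Real.exp (-(1 / 2) * t) * t ^ x
      ≤ Real.exp (-(1 / 2) * t) * Real.exp (-(1 / 2) * t) * (Real.exp (t / 2) * (2 * x) ^ x) := by
        gcongr
    _ = (Real.exp (t / 2) * Real.exp (-(1 / 2) * t)) * ((2 * x) ^ x * Real.exp (-(1 / 2) * t)) := by
        ring
    _ = _ := by rw [h4, one_mul]

/-- Moments of a random variable with a sub-Gaussian tail. -/
theorem lintegral_rpow_le_of_subgaussian {Ω : Type*} [MeasurableSpace Ω] (μ : Measure Ω)
    [IsFiniteMeasure μ] {X : Ω → ℝ} (hX : Measurable X) {b q : ℝ} (hb : 0 < b) (hq : 0 < q)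
    (h : ∀ t, 0 ≤ t → μ.real {ω | t < |X ω|} ≤ 2 * Real.exp (-(b * t ^ 2))) :
    ∫⁻ ω, ENNReal.ofReal (|X ω| ^ q) ∂μ ≤ ENNReal.ofReal (4 * (√q / √b) ^ q) := by
  rw [lintegral_rpow_eq_lintegral_meas_lt_mul μ (Eventually.of_forall fun ω => abs_nonneg (X ω))
    (by fun_prop) hq]
  have hint : IntegrableOn (fun t : ℝ => t ^ (q - 1) * Real.exp (-b * t ^ (2 : ℝ))) (Set.Ioi 0) :=
    integrableOn_rpow_mul_exp_neg_mul_rpow (by linarith) (by norm_num) hb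
  have h1 : ∫⁻ t in Set.Ioi (0 : ℝ), μ {ω | t < |X ω|} * ENNReal.ofReal (t ^ (q - 1)) ≤
      ∫⁻ t in Set.Ioi (0 : ℝ), ENNReal.ofReal
        (2 * (t ^ (q - 1) * Real.exp (-b * t ^ (2 : ℝ)))) := by
    refine setLIntegral_mono' measurableSet_Ioi fun t ht => ?_
    have ht : 0 < t := ht
    rw [← ofReal_measureReal, ← ENNReal.ofReal_mul measureReal_nonneg]
    refine ENNReal.ofReal_le_ofReal ?_
    have := h t ht.le
    calc _ ≤ 2 * Real.exp (-(b * t ^ 2)) * t ^ (q - 1) := by gcongr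
      _ = _ := by rw [Real.rpow_two, neg_mul]; ring
  refine (mul_le_mul_right h1 _).trans ?_
  rw [← ofReal_integral_eq_lintegral_ofReal (hint.const_mul 2), ← ENNReal.ofReal_mul hq.le]
  · refine ENNReal.ofReal_le_ofReal ?_
    rw [integral_const_mul, integral_rpow_mul_exp_neg_mul_rpow (by norm_num) (by linarith) hb]
    have hG := Real.Gamma_add_one_le (x := q / 2) (by positivity)
    rw [Real.Gamma_add_one (by positivity)] at hG
    have e1 : (2 * (q / 2)) ^ (q / 2) = √q ^ q := by
      rw [mul_div_cancel₀ _ two_ne_zero, Real.sqrt_eq_rpow, ← Real.rpow_mul hq.le]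
      congr 1; ring
    have e2 : b ^ (-(q - 1 + 1) / 2) = (√b ^ q)⁻¹ := by
      rw [Real.sqrt_eq_rpow, ← Real.rpow_mul hb.le, ← Real.rpow_neg hb.le]
      congr 1; ring
    rw [e1] at hG
    rw [e2, Real.div_rpow (by positivity) (by positivity), sub_add_cancel]
    have : 0 < (√b ^ q)⁻¹ := by positivity
    calc q * (2 * ((√b ^ q)⁻¹ * (1 / 2) * Real.Gamma (q / 2)))
        = 2 * (√b ^ q)⁻¹ * (q / 2 * Real.Gamma (q / 2)) := by ring
      _ ≤ 2 * (√b ^ q)⁻¹ * (2 * √q ^ q) := by gcongr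
      _ = _ := by rw [div_eq_mul_inv]; ring
  · filter_upwards [ae_restrict_mem measurableSet_Ioi] with t ht
    have ht : 0 < t := ht
    positivity

variable {N : ℕ}

local notation "𝔼" => EuclideanSpace ℝ (Fin N)

/-- The antipodal map preserves the uniform measure and exchanges the two half-spaces. -/
theorem isMedian_inner_zero (hN : 0 < N) (v : 𝔼) :
    IsMedian (unifSphere N) (fun a => inner ℝ (a : 𝔼) v) 0 := by
  have := isProbabilityMeasure_unifSphere hN
  have hc : Continuous fun a : Metric.sphere (0 : 𝔼) 1 => inner ℝ (a : 𝔼) v := by fun_prop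
  have hm : MeasurableSet {a : Metric.sphere (0 : 𝔼) 1 | 0 ≤ inner ℝ (a : 𝔼) v} :=
    measurableSet_le measurable_const hc.measurable
  have hneg : unifSphere N {a | inner ℝ (a : 𝔼) v ≤ 0} =
      unifSphere N {a | 0 ≤ inner ℝ (a : 𝔼) v} := by
    rw [← (measurePreserving_unifSphere (LinearIsometryEquiv.neg ℝ)).measure_preimage
      hm.nullMeasurableSet]
    congr 1
    ext a
    simp
  have hsum : 1 ≤ unifSphere N {a | 0 ≤ inner ℝ (a : 𝔼) v} +
      unifSphere N {a | inner ℝ (a : 𝔼) v ≤ 0} := by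
    rw [← measure_univ (μ := unifSphere N)]
    refine le_trans (measure_mono fun a _ => ?_) (measure_union_le _ _)
    exact le_total 0 (inner ℝ (a : 𝔼) v)
  rw [hneg, ← two_mul] at hsum
  have h : 1 / 2 ≤ unifSphere N {a | 0 ≤ inner ℝ (a : 𝔼) v} := by
    rw [ENNReal.div_le_iff_le_mul (by simp) (by simp), mul_comm]
    exact hsum
  exact ⟨h, hneg ▸ h⟩

/-- The linear form has median `0` and Lipschitz constant at most `s√N`, so the dimension cancels in
the concentration inequality, leaving a sub-Gaussian tail of scale `8s`. -/
theorem lintegral_abs_inner_rpow_le (hN : 0 < N) {q s : ℝ} (hq : 0 < q) (hs : 0 ≤ s) {v : 𝔼}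
    (hv : ‖v‖ ≤ s * √N) :
    ∫⁻ a, ENNReal.ofReal (|inner ℝ (a : 𝔼) v| ^ q) ∂unifSphere N ≤
      ENNReal.ofReal (4 * (8 * s * √q) ^ q) := by
  have hNR : (0 : ℝ) < N := by exact_mod_cast hN
  have := isProbabilityMeasure_unifSphere hN
  rcases hs.eq_or_lt with rfl | hs
  · have : v = 0 := by simpa using hv
    simp [this, Real.zero_rpow hq.ne']
  have hc : Continuous fun a : Metric.sphere (0 : 𝔼) 1 => inner ℝ (a : 𝔼) v := by fun_prop
  refine (lintegral_rpow_le_of_subgaussian (unifSphere N) hc.measurable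
    (b := 1 / (64 * s ^ 2)) (by positivity) hq fun t ht => ?_).trans_eq ?_
  · have := unifSphere_abs_sub_median_gt_le hN (L := s * √N) (r := t) (by positivity) (fun a b => by
      rw [← inner_sub_left, mul_comm]
      refine (real_inner_le_norm _ _).trans ?_
      gcongr) (isMedian_inner_zero hN v) ht
    simp only [sub_zero] at this
    refine this.trans_eq ?_
    congr 3
    rw [mul_pow, Real.sq_sqrt hNR.le]
    field_simp
  · congr 3
    have : √(1 / (64 * s ^ 2)) = 1 / (8 * s) := by
      rw [Real.sqrt_eq_iff_mul_self_eq (by positivity) (by positivity)]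
      field_simp
      norm_num
    rw [this]
    field_simp

end Moment

/-! ### Harmonic polynomials: dimension and decomposition. -/

section Harmonic

open MvPolynomial

local notation "𝓟" => MvPolynomial (Fin 4) ℝ
local notation "Hom" => homogeneousSubmodule (Fin 4) ℝ

theorem finite_homogeneousSubmodule (d : ℕ) : Module.Finite ℝ (Hom d) :=
  Module.Finite.iff_fg.2 (homogeneousSubmodule_fg (Fin 4) ℝ d)

theorem finrank_homogeneousSubmodule (d : ℕ) : Module.finrank ℝ (Hom d) = (d + 3).choose 3 := by
  rw [homogeneousSubmodule_eq_finsupp_supported,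
    (AddMonoidAlgebra.supportedEquivFinsupp {α : Fin 4 →₀ ℕ | α.degree = d}).finrank_eq]
  have e : {α : Fin 4 →₀ ℕ | α.degree = d} = ((Finset.univ : Finset (Fin 4)).finsuppAntidiag d :
      Set (Fin 4 →₀ ℕ)) := by
    ext α
    simp [Finset.mem_finsuppAntidiag, Finsupp.degree_eq_sum]
  rw [e, Module.finrank_finsupp_self]
  rw [← Nat.card_eq_fintype_card, SetLike.coe_sort_coe, Nat.card_eq_fintype_card,
    Fintype.card_coe, Finset.card_finsuppAntidiag_nat_eq_choose]
  simp only [Finset.card_univ, Fintype.card_fin]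
  rw [show 4 + d - 1 = d + 3 by omega, ← Nat.choose_symm_add]

/-- The Fischer pairing on polynomials, for which the monomials are orthogonal with
`⟪x ^ α, x ^ α⟫ = α!`. -/
noncomputable def fischer : 𝓟 →ₗ[ℝ] 𝓟 →ₗ[ℝ] ℝ :=
  (basisMonomials (Fin 4) ℝ).constr ℝ fun α => (∏ i, (α i).factorial : ℝ) • lcoeff ℝ α

theorem fischer_monomial (α : Fin 4 →₀ ℕ) (Q : 𝓟) :
    fischer (monomial α 1) Q = (∏ i, (α i).factorial : ℝ) * coeff α Q := by
  have := (basisMonomials (Fin 4) ℝ).constr_basis ℝ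
    (fun α => (∏ i, (α i).factorial : ℝ) • lcoeff ℝ α) α
  rw [coe_basisMonomials] at this
  rw [fischer, this]
  rfl

theorem fischer_apply (P Q : 𝓟) :
    fischer P Q = ∑ α ∈ P.support, (∏ i, (α i).factorial : ℝ) * (coeff α P * coeff α Q) := by
  conv_lhs => rw [P.as_sum]
  rw [map_sum, LinearMap.sum_apply]
  refine Finset.sum_congr rfl fun α _ => ?_
  rw [← mul_one (coeff α P), ← smul_eq_mul, ← smul_monomial, map_smul, LinearMap.smul_apply,
    fischer_monomial]
  simp only [smul_eq_mul]
  ring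

theorem eq_zero_of_fischer_self_eq_zero {P : 𝓟} (h : fischer P P = 0) : P = 0 := by
  rw [fischer_apply, Finset.sum_eq_zero_iff_of_nonneg
    (fun α _ => mul_nonneg (by positivity) (mul_self_nonneg _))] at h
  ext α
  by_contra hα
  have := h α (mem_support_iff.2 hα)
  have hf : (∏ i, (α i).factorial : ℝ) ≠ 0 := by positivity
  simp [hf] at this
  exact hα this

/-- Multiplication by a variable is adjoint to differentiation because `(α + eᵢ)! = (αᵢ + 1) α!`.
Hence multiplication by `|x|²` is adjoint to the Laplacian. -/
theorem fischer_X_mul (i : Fin 4) (P Q : 𝓟) : fischer (X i * P) Q = fischer P (pderiv i Q) := by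
  induction P using MvPolynomial.induction_on' with
  | add p q hp hq => simp only [mul_add, map_add, LinearMap.add_apply, hp, hq]
  | monomial α a =>
    have e1 : (X i * monomial α a : 𝓟) = a • monomial (α + Finsupp.single i 1) 1 := by
      rw [X, monomial_mul, smul_monomial, add_comm]; simp
    have e2 : (monomial α a : 𝓟) = a • monomial α 1 := by rw [smul_monomial]; simp
    rw [e1, e2, map_smul, map_smul, LinearMap.smul_apply, LinearMap.smul_apply, fischer_monomial,
      fischer_monomial, coeff_pderiv]
    have e3 : (∏ j : Fin 4, ((α + Finsupp.single i 1 : Fin 4 →₀ ℕ) j).factorial : ℝ) =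
        (α i + 1) * ∏ j : Fin 4, ((α j).factorial : ℝ) := by
      rw [← Finset.mul_prod_erase _ _ (Finset.mem_univ i),
        ← Finset.mul_prod_erase (Finset.univ) (fun j => ((α j).factorial : ℝ)) (Finset.mem_univ i)]
      rw [Finset.prod_congr rfl (g := fun j => ((α j).factorial : ℝ)) fun j hj => by
        rw [Finsupp.add_apply, Finsupp.single_eq_of_ne (Finset.ne_of_mem_erase hj), add_zero]]
      simp only [Finsupp.coe_add, Pi.add_apply, Finsupp.single_eq_same, Nat.factorial_succ]
      push_cast
      ring
    rw [e3]
    simp only [smul_eq_mul]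
    ring

/-- The polynomial `|x|²`. -/
noncomputable def normSqPoly : 𝓟 := ∑ i, X i * X i

theorem polyLaplacian_apply (P : 𝓟) : polyLaplacian P = ∑ i, pderiv i (pderiv i P) := by
  simp [polyLaplacian]

theorem fischer_normSqPoly_mul (P Q : 𝓟) :
    fischer (normSqPoly * P) Q = fischer P (polyLaplacian Q) := by
  rw [normSqPoly, Finset.sum_mul, map_sum, LinearMap.sum_apply, polyLaplacian_apply, map_sum]
  refine Finset.sum_congr rfl fun i _ => ?_
  rw [mul_assoc, fischer_X_mul, fischer_X_mul]

theorem isHomogeneous_normSqPoly : normSqPoly.IsHomogeneous 2 :=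
  IsHomogeneous.sum _ _ _ fun i _ => (isHomogeneous_X ℝ i).mul (isHomogeneous_X ℝ i)

theorem normSqPoly_ne_zero : normSqPoly ≠ 0 := by
  intro h
  have := congrArg (eval fun _ => (1 : ℝ)) h
  simp [normSqPoly] at this

theorem isHomogeneous_polyLaplacian {P : 𝓟} {d : ℕ} (h : P.IsHomogeneous (d + 2)) :
    (polyLaplacian P).IsHomogeneous d := by
  rw [polyLaplacian_apply]
  exact IsHomogeneous.sum _ _ _ fun i _ => h.pderiv.pderiv

/-- Rank–nullity for the Laplacian from degree `d + 2` to degree `d`; surjectivity is not needed. -/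
theorem finrank_homogeneousSubmodule_le (d : ℕ) :
    Module.finrank ℝ (Hom (d + 2)) ≤
      Module.finrank ℝ (harmonicPoly (d + 2)) + Module.finrank ℝ (Hom d) := by
  have := finite_homogeneousSubmodule (d + 2)
  have := finite_homogeneousSubmodule d
  let T := polyLaplacian.domRestrict (Hom (d + 2))
  have hk : Module.finrank ℝ (LinearMap.ker T) = Module.finrank ℝ (harmonicPoly (d + 2)) := by
    rw [LinearMap.ker_domRestrict, harmonicPoly, ← Submodule.map_comap_subtype]
    exact (Submodule.equivSubtypeMap _ _).finrank_eq
  have hr : Module.finrank ℝ (LinearMap.range T) ≤ Module.finrank ℝ (Hom d) := by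
    refine Submodule.finrank_mono ?_
    rintro _ ⟨P, rfl⟩
    exact isHomogeneous_polyLaplacian P.2
  have := T.finrank_range_add_finrank_ker
  omega

/-- If `P = |x|² Q` is harmonic, adjointness gives `⟨P, P⟩ = ⟨Q, ΔP⟩ = 0`, and the pairing is
positive definite. -/
theorem harmonicPoly_inf_map_normSqPoly (d e : ℕ) :
    harmonicPoly d ⊓ (Hom e).map (LinearMap.mulLeft ℝ normSqPoly) = ⊥ := by
  rw [eq_bot_iff]
  rintro _ ⟨⟨-, hP⟩, Q, -, rfl⟩
  refine eq_zero_of_fischer_self_eq_zero ?_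
  rw [LinearMap.mulLeft_apply] at hP ⊢
  rw [fischer_normSqPoly_mul, LinearMap.mem_ker.1 hP, map_zero]

theorem finrank_map_mulLeft_normSqPoly (d : ℕ) :
    Module.finrank ℝ ((Hom d).map (LinearMap.mulLeft ℝ normSqPoly)) = Module.finrank ℝ (Hom d) :=
  (Submodule.equivMapOfInjective _ (mul_right_injective₀ normSqPoly_ne_zero) _).finrank_eq.symm

theorem sup_map_normSqPoly_le (d : ℕ) :
    harmonicPoly (d + 2) ⊔ (Hom d).map (LinearMap.mulLeft ℝ normSqPoly) ≤ Hom (d + 2) := by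
  refine sup_le inf_le_left ?_
  rintro _ ⟨Q, hQ, rfl⟩
  have := isHomogeneous_normSqPoly.mul ((mem_homogeneousSubmodule _ _).1 hQ)
  rw [add_comm] at this
  exact this

/-- The trivial intersection bounds the sum of the dimensions above by that of the degree `d + 2`
polynomials, and rank–nullity bounds it below; equality forces the direct sum to fill the whole
space. -/
theorem finrank_harmonicPoly_add (d : ℕ) :
    Module.finrank ℝ (harmonicPoly (d + 2)) + Module.finrank ℝ (Hom d) =
      Module.finrank ℝ (Hom (d + 2)) ∧
    harmonicPoly (d + 2) ⊔ (Hom d).map (LinearMap.mulLeft ℝ normSqPoly) = Hom (d + 2) := by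
  have := finite_homogeneousSubmodule (d + 2)
  have := finite_homogeneousSubmodule d
  have : Module.Finite ℝ (harmonicPoly (d + 2)) := Submodule.finiteDimensional_inf_left _ _
  have h1 := Submodule.finrank_sup_add_finrank_inf_eq (harmonicPoly (d + 2))
    ((Hom d).map (LinearMap.mulLeft ℝ normSqPoly))
  rw [harmonicPoly_inf_map_normSqPoly, finrank_bot, add_zero,
    finrank_map_mulLeft_normSqPoly] at h1
  have h2 := Submodule.finrank_mono (sup_map_normSqPoly_le d)
  have h3 := finrank_homogeneousSubmodule_le d
  have h4 := le_antisymm h3 (h1 ▸ h2)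
  refine ⟨h4.symm, Submodule.eq_of_le_of_finrank_eq (sup_map_normSqPoly_le d) ?_⟩
  omega

theorem harmonicPoly_eq_of_le_one {d : ℕ} (hd : d ≤ 1) : harmonicPoly d = Hom d := by
  refine inf_eq_left.2 fun P hP => LinearMap.mem_ker.2 ?_
  rw [polyLaplacian_apply]
  refine Finset.sum_eq_zero fun i _ => ?_
  have h := ((mem_homogeneousSubmodule _ _).1 hP).pderiv (i := i)
  rw [Nat.sub_eq_zero_of_le hd, ← totalDegree_zero_iff_isHomogeneous,
    totalDegree_eq_zero_iff_eq_C] at h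
  rw [h, pderiv_C]

theorem finrank_harmonicPoly (d : ℕ) : Module.finrank ℝ (harmonicPoly d) = (d + 1) ^ 2 := by
  match d with
  | 0 => rw [harmonicPoly_eq_of_le_one zero_le_one, finrank_homogeneousSubmodule]; rfl
  | 1 => rw [harmonicPoly_eq_of_le_one le_rfl, finrank_homogeneousSubmodule]; rfl
  | d + 2 =>
    have h := (finrank_harmonicPoly_add d).1
    rw [finrank_homogeneousSubmodule, finrank_homogeneousSubmodule] at h
    have h1 : (d + 2 + 3).choose 3 = (d + 3).choose 3 + (d + 2 + 1) ^ 2 := by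
      have a1 := Nat.choose_succ_succ' (d + 4) 2
      have a2 := Nat.choose_succ_succ' (d + 3) 2
      have a3 := Nat.choose_succ_succ' (d + 3) 1
      have a4 := Nat.triangle_succ (d + 3)
      simp only [Nat.choose_one_right] at a3
      have a5 : (d + 3).choose 2 * 2 = (d + 3) * (d + 2) := by
        rw [Nat.choose_two_right, Nat.div_mul_cancel (by
          rw [mul_comm]; exact (Nat.even_mul_succ_self (d + 2)).two_dvd)]
        rfl
      simp only [Nat.reduceAdd, add_assoc] at a1 a2 a3 ⊢
      rw [a1, a2, a3]
      nlinarith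
    omega

/-- Restrictions to the sphere of polynomials are sums of restrictions of harmonic ones. -/
theorem restrictS3_mem_iSup (P : 𝓟) :
    restrictS3 P ∈ ⨆ d, (harmonicPoly d).map restrictS3 := by
  -- On the sphere the factor `|x|²` equals `1`, so the decomposition can be iterated with the
  -- degree dropping by two.
  have hr : ∀ Q : 𝓟, restrictS3 (normSqPoly * Q) = restrictS3 Q := by
    intro Q
    ext x
    have hx : ∑ i, (x : EuclideanSpace ℝ (Fin 4)) i * (x : EuclideanSpace ℝ (Fin 4)) i = 1 := by
      have := EuclideanSpace.real_norm_sq_eq (x : EuclideanSpace ℝ (Fin 4))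
      rw [norm_eq_of_mem_sphere] at this
      simp_rw [← sq]
      linarith
    change eval _ (normSqPoly * Q) = eval _ Q
    rw [map_mul, normSqPoly]
    simp [hx]
  have hhom : ∀ d, ∀ P ∈ Hom d, restrictS3 P ∈ ⨆ d, (harmonicPoly d).map restrictS3 := by
    intro d
    induction d using Nat.strong_induction_on with
    | _ d ih =>
      intro P hP
      match d with
      | 0 => exact Submodule.mem_iSup_of_mem 0
              ⟨P, by rw [harmonicPoly_eq_of_le_one zero_le_one]; exact hP, rfl⟩
      | 1 => exact Submodule.mem_iSup_of_mem 1
              ⟨P, by rw [harmonicPoly_eq_of_le_one le_rfl]; exact hP, rfl⟩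
      | d + 2 =>
        rw [← (finrank_harmonicPoly_add d).2] at hP
        obtain ⟨H, hH, _, ⟨Q, hQ, rfl⟩, rfl⟩ := Submodule.mem_sup.1 hP
        rw [map_add, LinearMap.mulLeft_apply, hr]
        exact Submodule.add_mem _ (Submodule.mem_iSup_of_mem (d + 2) ⟨H, hH, rfl⟩)
          (ih d (by omega) Q hQ)
  rw [← P.sum_homogeneousComponent, map_sum]
  exact Submodule.sum_mem _ fun d _ => hhom d _ (homogeneousComponent_mem d P)

end Harmonic

/-! ### Spherical harmonics, rotation invariance and zonal harmonics. -/

section SphericalHarmonics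

open MvPolynomial

local notation "𝓟" => MvPolynomial (Fin 4) ℝ
local notation "Hom" => homogeneousSubmodule (Fin 4) ℝ
local notation "ℝ⁴" => EuclideanSpace ℝ (Fin 4)

instance : surf.IsOpenPosMeasure := by unfold surf; infer_instance

theorem restrictS3_apply (P : 𝓟) (x : S3) : restrictS3 P x = eval (x : ℝ⁴).ofLp P := rfl

theorem eval_smul_of_isHomogeneous {P : 𝓟} {d : ℕ} (hP : P.IsHomogeneous d) (r : ℝ)
    (x : Fin 4 → ℝ) : eval (r • x) P = r ^ d * eval x P := by
  rw [eval_eq, eval_eq, Finset.mul_sum]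
  refine Finset.sum_congr rfl fun α hα => ?_
  have : ∑ i ∈ α.support, α i = d := by
    have := hP (mem_support_iff.1 hα)
    simpa [Finsupp.weight_apply, Finsupp.sum] using this
  simp only [Pi.smul_apply, smul_eq_mul, mul_pow, Finset.prod_mul_distrib,
    Finset.prod_pow_eq_pow_sum, this]
  ring

theorem eq_zero_of_restrictS3_eq_zero {P : 𝓟} {d : ℕ} (hP : P.IsHomogeneous d)
    (h : restrictS3 P = 0) : P = 0 := by
  have key : ∀ y : ℝ⁴, y ≠ 0 → eval y.ofLp P = 0 := by
    intro y hy
    have hy' : ‖y‖ ≠ 0 := norm_ne_zero_iff.2 hy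
    have hm : ‖y‖⁻¹ • y ∈ Metric.sphere (0 : ℝ⁴) 1 := by
      simp [norm_smul, hy']
    have h1 : eval (‖y‖⁻¹ • y).ofLp P = 0 := DFunLike.congr_fun h (⟨_, hm⟩ : S3)
    have h2 : y.ofLp = ‖y‖ • (‖y‖⁻¹ • y).ofLp := by
      rw [WithLp.ofLp_smul, smul_smul, mul_inv_cancel₀ hy', one_smul]
    rw [h2, eval_smul_of_isHomogeneous hP, h1, mul_zero]
  -- Multiplying by a variable makes the product vanish at the origin as well, where homogeneity
  -- gives nothing in degree `0`.
  have hX : X 0 * P = 0 := MvPolynomial.funext fun x => by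
    rw [map_mul, eval_X, map_zero]
    by_cases hx : x = 0
    · simp [hx]
    · rw [key (WithLp.toLp 2 x) (by simpa using hx), mul_zero]
  exact (mul_eq_zero.1 hX).resolve_left (X_ne_zero 0)

/-- The spherical harmonics of degree `n - 1`, as continuous functions. -/
noncomputable def contHarm (n : ℕ+) : Submodule ℝ C(S3, ℝ) :=
  (harmonicPoly ((n : ℕ) - 1)).map restrictS3

theorem finrank_contHarm (n : ℕ+) : Module.finrank ℝ (contHarm n) = (n : ℕ) ^ 2 := by
  rw [contHarm, ← LinearMap.range_domRestrict]
  rw [LinearMap.finrank_range_of_inj, finrank_harmonicPoly, Nat.sub_add_cancel n.pos]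
  rw [injective_iff_map_eq_zero]
  rintro ⟨P, hP⟩ h
  exact Subtype.ext (eq_zero_of_restrictS3_eq_zero hP.1 h)

theorem SphHarm_eq_map (n : ℕ+) :
    SphHarm n = (contHarm n).map (ContinuousMap.toLp 2 surf ℝ).toLinearMap := by
  rw [contHarm, SphHarm, Submodule.map_comp]

/-- Continuous representatives of spherical harmonics. -/
noncomputable def contHarmEquiv (n : ℕ+) : contHarm n ≃ₗ[ℝ] SphHarm n :=
  (Submodule.equivMapOfInjective _ (ContinuousMap.toLp_injective surf (p := 2) (𝕜 := ℝ))
    (contHarm n)).trans (LinearEquiv.ofEq _ _ (SphHarm_eq_map n).symm)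

theorem coe_contHarmEquiv {n : ℕ+} (g : contHarm n) :
    (contHarmEquiv n g : L2S3) = ContinuousMap.toLp 2 surf ℝ (g : C(S3, ℝ)) := rfl

theorem finrank_SphHarm (n : ℕ+) : Module.finrank ℝ (SphHarm n) = (n : ℕ) ^ 2 :=
  (contHarmEquiv n).finrank_eq.symm.trans (finrank_contHarm n)

instance (n : ℕ+) : FiniteDimensional ℝ (SphHarm n) :=
  FiniteDimensional.of_finrank_pos (by rw [finrank_SphHarm]; exact pow_pos n.pos 2)

/-- The continuous representative of a spherical harmonic. -/
noncomputable def contRep {n : ℕ+} (u : SphHarm n) : C(S3, ℝ) := (contHarmEquiv n).symm u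

theorem toLp_contRep {n : ℕ+} (u : SphHarm n) :
    ContinuousMap.toLp 2 surf ℝ (contRep u) = (u : L2S3) := by
  rw [contRep, ← coe_contHarmEquiv, LinearEquiv.apply_symm_apply]

theorem contRep_mem {n : ℕ+} (u : SphHarm n) : contRep u ∈ contHarm n := Subtype.coe_prop _

theorem coeFn_ae_eq_contRep {n : ℕ+} (u : SphHarm n) : (u : L2S3) =ᵐ[surf] contRep u := by
  rw [← toLp_contRep u]
  exact ContinuousMap.coeFn_toLp surf (contRep u)

theorem inner_eq_integral_contRep {n m : ℕ+} (u : SphHarm n) (v : SphHarm m) :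
    inner ℝ (u : L2S3) (v : L2S3) = ∫ x, contRep u x * contRep v x ∂surf := by
  rw [← toLp_contRep u, ← toLp_contRep v, ContinuousMap.inner_toLp]
  simp [mul_comm]

theorem measurePreserving_surf (e : ℝ⁴ ≃ₗᵢ[ℝ] ℝ⁴) : MeasurePreserving (sphereMap e) surf surf :=
  measurePreserving_sphereMap e

/-- The composition of a polynomial with the linear map of an orthogonal matrix. -/
noncomputable def compOGroup (U : OGroup 4) : 𝓟 →ₐ[ℝ] 𝓟 :=
  aeval fun i => ∑ j, C ((U : Matrix (Fin 4) (Fin 4) ℝ) i j) * X j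

theorem eval_compOGroup (U : OGroup 4) (P : 𝓟) (x : ℝ⁴) :
    eval x.ofLp (compOGroup U P) = eval (U.isometry x).ofLp P := by
  rw [OGroup.isometry_apply]
  change (eval x.ofLp) (aeval _ P) = _
  rw [← MvPolynomial.coe_aeval_eq_eval, ← MvPolynomial.coe_aeval_eq_eval]
  change (aeval x.ofLp) (aeval _ P) = aeval _ P
  rw [← AlgHom.comp_apply, MvPolynomial.comp_aeval]
  have h : (fun i => aeval x.ofLp (∑ j, C ((U : Matrix (Fin 4) (Fin 4) ℝ) i j) * X j : 𝓟)) =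
      (U : Matrix (Fin 4) (Fin 4) ℝ).mulVec x.ofLp := by
    ext i
    simp [Matrix.mulVec, dotProduct]
  exact congrArg (fun g => aeval g P) h

theorem restrictS3_compOGroup (U : OGroup 4) (P : 𝓟) :
    restrictS3 (compOGroup U P) =
      (restrictS3 P).comp ⟨sphereMap U.isometry, continuous_sphereMap _⟩ := by
  ext x
  exact eval_compOGroup U P x

theorem pderiv_compOGroup (U : OGroup 4) (j : Fin 4) (P : 𝓟) :
    pderiv j (compOGroup U P) =
      ∑ i, C ((U : Matrix (Fin 4) (Fin 4) ℝ) i j) * compOGroup U (pderiv i P) := by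
  induction P using MvPolynomial.induction_on with
  | C a => simp
  | add p q hp hq => simp only [map_add, hp, hq, mul_add, Finset.sum_add_distrib]
  | mul_X p k hp =>
    have hX : ∀ i, compOGroup U (pderiv i (X k)) = if k = i then 1 else 0 := by
      intro i
      rw [pderiv_X, Pi.single_apply]
      split_ifs <;> simp
    have hk : pderiv j (compOGroup U (X k)) = C ((U : Matrix (Fin 4) (Fin 4) ℝ) k j) := by
      simp only [compOGroup, aeval_X, map_sum, pderiv_C_mul, pderiv_X, Pi.single_apply]
      simp
    rw [map_mul, pderiv_mul, hp, hk]
    simp only [pderiv_mul, map_add, map_mul, hX, mul_add, Finset.sum_add_distrib, mul_ite, mul_one,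
      mul_zero, Finset.sum_ite_eq, Finset.mem_univ, if_true, Finset.sum_mul]
    congr 1
    · exact Finset.sum_congr rfl fun i _ => by ring
    · ring

theorem polyLaplacian_compOGroup (U : OGroup 4) (P : 𝓟) :
    polyLaplacian (compOGroup U P) = compOGroup U (polyLaplacian P) := by
  have hU : ∀ i k, ∑ j, (U : Matrix (Fin 4) (Fin 4) ℝ) i j * (U : Matrix (Fin 4) (Fin 4) ℝ) k j =
      if i = k then 1 else 0 := by
    intro i k
    have := (Matrix.mem_orthogonalGroup_iff (Fin 4) ℝ).1 U.2
    have := congrFun (congrFun this i) k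
    rw [Matrix.mul_apply, Matrix.one_apply] at this
    exact this
  simp only [polyLaplacian_apply, pderiv_compOGroup, map_sum, pderiv_C_mul, Finset.mul_sum]
  rw [Finset.sum_comm]
  refine Finset.sum_congr rfl fun i _ => ?_
  rw [Finset.sum_comm]
  calc _ = ∑ k, C (∑ j, (U : Matrix (Fin 4) (Fin 4) ℝ) i j *
        (U : Matrix (Fin 4) (Fin 4) ℝ) k j) * compOGroup U (pderiv k (pderiv i P)) := by
        refine Finset.sum_congr rfl fun k _ => ?_
        rw [map_sum, Finset.sum_mul]
        refine Finset.sum_congr rfl fun j _ => ?_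
        rw [C_mul]; ring
    _ = _ := by
        simp [hU]

theorem compOGroup_mem_harmonicPoly (U : OGroup 4) {d : ℕ} {P : 𝓟} (hP : P ∈ harmonicPoly d) :
    compOGroup U P ∈ harmonicPoly d := by
  refine ⟨?_, ?_⟩
  · have h := ((mem_homogeneousSubmodule _ _).1 hP.1).aeval (n := 1)
      (fun i => ∑ j, C ((U : Matrix (Fin 4) (Fin 4) ℝ) i j) * X j)
      fun i => IsHomogeneous.sum _ _ _ fun j _ => isHomogeneous_C_mul_X _ j
    rw [one_mul] at h
    exact h
  · change polyLaplacian _ = 0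
    rw [polyLaplacian_compOGroup, LinearMap.mem_ker.1 hP.2, map_zero]

theorem comp_sphereMap_mem_contHarm (U : OGroup 4) {n : ℕ+} {g : C(S3, ℝ)} (hg : g ∈ contHarm n) :
    g.comp ⟨sphereMap U.isometry, continuous_sphereMap _⟩ ∈ contHarm n := by
  obtain ⟨P, hP, rfl⟩ := hg
  exact ⟨_, compOGroup_mem_harmonicPoly U hP, restrictS3_compOGroup U P⟩

/-- The point evaluation functional on spherical harmonics. -/
noncomputable def evalHarm (n : ℕ+) (x : S3) : SphHarm n →L[ℝ] ℝ :=
  LinearMap.toContinuousLinearMap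
    { toFun := fun u => contRep u x
      map_add' := fun u v => by simp [contRep]
      map_smul' := fun c u => by simp [contRep] }

/-- The zonal harmonic at `x`, which represents the evaluation at `x`. -/
noncomputable def zonal (n : ℕ+) (x : S3) : SphHarm n :=
  (InnerProductSpace.toDual ℝ (SphHarm n)).symm (evalHarm n x)

theorem inner_zonal {n : ℕ+} (x : S3) (u : SphHarm n) : inner ℝ (zonal n x) u = contRep u x := by
  rw [zonal, InnerProductSpace.toDual_symm_apply]
  rfl

/-- Let `z` be the zonal harmonic at `Ux` and `w = z ∘ U`, again a harmonic of the same norm. Then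
`‖z‖² = z(Ux) = w(x)`, which Cauchy–Schwarz bounds by `‖zonal n x‖ ‖z‖`. -/
theorem norm_zonal_sphereMap_le {n : ℕ+} (U : OGroup 4) (x : S3) :
    ‖zonal n (sphereMap U.isometry x)‖ ≤ ‖zonal n x‖ := by
  set z := zonal n (sphereMap U.isometry x) with hz
  let g : contHarm n := ⟨_, comp_sphereMap_mem_contHarm U (contRep_mem z)⟩
  let w : SphHarm n := contHarmEquiv n g
  have hw : contRep w = (contRep z).comp ⟨sphereMap U.isometry, continuous_sphereMap _⟩ := by
    simp [contRep, w, g]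
  have h1 : ‖z‖ ^ 2 = inner ℝ (zonal n x) w := by
    rw [inner_zonal, hw, ← real_inner_self_eq_norm_sq]
    conv_lhs => rw [hz]
    rw [inner_zonal]
    rfl
  have h2 : ‖w‖ ^ 2 = ‖z‖ ^ 2 := by
    rw [← real_inner_self_eq_norm_sq, ← real_inner_self_eq_norm_sq, Submodule.coe_inner,
      Submodule.coe_inner, inner_eq_integral_contRep, inner_eq_integral_contRep, hw]
    exact (measurePreserving_surf U.isometry).integral_comp'
      (f := (U.isometry.toHomeomorph.sets (s := Metric.sphere (0 : ℝ⁴) 1)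
        (t := Metric.sphere 0 1) (by ext; simp)).toMeasurableEquiv)
      (fun x => contRep z x * contRep z x)
  have h3 := real_inner_le_norm (zonal n x) w
  have h4 : ‖w‖ = ‖z‖ := (sq_eq_sq₀ (norm_nonneg _) (norm_nonneg _)).1 h2
  rw [← h1, h4, sq] at h3
  rcases (norm_nonneg z).eq_or_lt with h | h
  · rw [← h]; exact norm_nonneg _
  · exact le_of_mul_le_mul_right h3 h

theorem norm_zonal_eq {n : ℕ+} (x y : S3) : ‖zonal n x‖ = ‖zonal n y‖ := by
  have key : ∀ x y : S3, ‖zonal n y‖ ≤ ‖zonal n x‖ := by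
    intro x y
    obtain ⟨e, rfl⟩ := exists_sphereMap_eq x y
    obtain ⟨U, rfl⟩ := OGroup.exists_isometry_eq e
    exact norm_zonal_sphereMap_le U x
  exact le_antisymm (key y x) (key x y)

theorem surf_real_univ_pos : 0 < surf.real Set.univ := by
  rw [measureReal_def]
  refine ENNReal.toReal_pos ?_ (measure_ne_top _ _)
  exact mt Measure.measure_univ_eq_zero.1 (Measure.toSphere_ne_zero (volume : Measure ℝ⁴))

/-- The squares of an orthonormal basis at `y` sum to `‖zonal n y‖²`, which is constant in `y`;
integrating over the sphere counts the basis vectors. -/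
theorem norm_zonal_sq (n : ℕ+) (x : S3) :
    ‖zonal n x‖ ^ 2 * surf.real Set.univ = (n : ℝ) ^ 2 := by
  let f := stdOrthonormalBasis ℝ (SphHarm n)
  have h1 : ∀ y, ∑ k, contRep (f k) y ^ 2 = ‖zonal n x‖ ^ 2 := by
    intro y
    rw [norm_zonal_eq x y, ← f.sum_sq_norm_inner_left (zonal n y)]
    refine Finset.sum_congr rfl fun k _ => ?_
    rw [inner_zonal, Real.norm_eq_abs, sq_abs]
  have h2 : ∫ y, ∑ k, contRep (f k) y ^ 2 ∂surf = (n : ℝ) ^ 2 := by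
    rw [integral_finsetSum]
    · have : ∀ k, ∫ y, contRep (f k) y ^ 2 ∂surf = 1 := by
        intro k
        simp_rw [sq]
        rw [← inner_eq_integral_contRep, ← Submodule.coe_inner, real_inner_self_eq_norm_sq,
          f.orthonormal.1 k, one_pow]
      simp [this, finrank_SphHarm]
    · intro k _
      exact (((contRep (f k)).continuous.pow 2).integrable_of_hasCompactSupport
        (HasCompactSupport.of_compactSpace _))
  simp_rw [h1] at h2
  rw [integral_const, smul_eq_mul, mul_comm] at h2
  exact h2

end SphericalHarmonics

/-! ### Orthogonality of different degrees through Gaussian integrals. -/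

section GaussianWeight

open MvPolynomial

local notation "𝓟" => MvPolynomial (Fin 4) ℝ
local notation "ℝ⁴" => EuclideanSpace ℝ (Fin 4)

theorem continuous_eval_ofLp (P : 𝓟) : Continuous fun x : ℝ⁴ => eval x.ofLp P :=
  (continuous_eval P).comp (by fun_prop)

/-- All `ε` are treated at once so that the induction can spend `ε/2` on the polynomial and `ε/2` on
the new variable. -/
theorem exists_abs_eval_le_exp (P : 𝓟) : ∀ ε : ℝ, 0 < ε →
    ∃ K, ∀ x : ℝ⁴, |eval x.ofLp P| ≤ K * Real.exp (ε * ‖x‖ ^ 2) := by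
  induction P using MvPolynomial.induction_on with
  | C a =>
    intro ε hε
    refine ⟨|a|, fun x => ?_⟩
    rw [eval_C]
    exact le_mul_of_one_le_right (abs_nonneg a) (Real.one_le_exp (by positivity))
  | add p q hp hq =>
    intro ε hε
    obtain ⟨K, hK⟩ := hp ε hε
    obtain ⟨L, hL⟩ := hq ε hε
    refine ⟨K + L, fun x => ?_⟩
    rw [map_add, add_mul]
    exact (abs_add_le _ _).trans (add_le_add (hK x) (hL x))
  | mul_X p i hp =>
    intro ε hε
    obtain ⟨K, hK⟩ := hp (ε / 2) (by positivity)
    refine ⟨K * (1 + 2 / ε), fun x => ?_⟩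
    have h1 : |x i| ≤ (1 + 2 / ε) * Real.exp (ε / 2 * ‖x‖ ^ 2) := by
      have ha : |x i| ≤ ‖x‖ := PiLp.norm_apply_le x i
      have hb := Real.add_one_le_exp (ε / 2 * ‖x‖ ^ 2)
      have hc : (1 + 2 / ε) * (ε / 2 * ‖x‖ ^ 2 + 1) =
          ‖x‖ ^ 2 + 1 + (ε / 2 * ‖x‖ ^ 2 + 2 / ε) := by
        field_simp
        ring
      have hd : 0 ≤ ε / 2 * ‖x‖ ^ 2 + 2 / ε := by positivity
      have he : ‖x‖ ≤ ‖x‖ ^ 2 + 1 := by nlinarith [sq_nonneg (‖x‖ - 1), norm_nonneg x]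
      have hf : (1 + 2 / ε) * (ε / 2 * ‖x‖ ^ 2 + 1) ≤
          (1 + 2 / ε) * Real.exp (ε / 2 * ‖x‖ ^ 2) := by gcongr
      linarith
    rw [map_mul, eval_X, abs_mul]
    calc _ ≤ K * Real.exp (ε / 2 * ‖x‖ ^ 2) * ((1 + 2 / ε) * Real.exp (ε / 2 * ‖x‖ ^ 2)) :=
          mul_le_mul (hK x) h1 (abs_nonneg _) ((abs_nonneg _).trans (hK x))
      _ = K * (1 + 2 / ε) * (Real.exp (ε / 2 * ‖x‖ ^ 2) * Real.exp (ε / 2 * ‖x‖ ^ 2)) := by ring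
      _ = _ := by rw [← Real.exp_add]; congr 2; ring

theorem integrable_exp_neg_mul_norm_sq {b : ℝ} (hb : 0 < b) :
    Integrable fun x : ℝ⁴ => Real.exp (-(b * ‖x‖ ^ 2)) := by
  have := (GaussianFourier.integrable_cexp_neg_mul_sq_norm_add (V := ℝ⁴) (b := b) (by simpa) 0 0).re
  refine this.congr (Eventually.of_forall fun x => ?_)
  have : (-(b : ℂ) * ‖x‖ ^ 2 + 0 * (inner ℝ (0 : ℝ⁴) x : ℝ)) = ((-(b * ‖x‖ ^ 2) : ℝ) : ℂ) := by
    push_cast; ring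
  simp only [this]
  exact Complex.exp_ofReal_re _

theorem integrable_eval_mul_gaussian (P : 𝓟) :
    Integrable fun x : ℝ⁴ => eval x.ofLp P * Real.exp (-‖x‖ ^ 2) := by
  obtain ⟨K, hK⟩ := exists_abs_eval_le_exp P (1 / 2) (by norm_num)
  refine ((integrable_exp_neg_mul_norm_sq (b := 1 / 2) (by norm_num)).const_mul K).mono'
    ((continuous_eval_ofLp P).mul (by fun_prop)).aestronglyMeasurable
    (Eventually.of_forall fun x => ?_)
  rw [norm_mul, Real.norm_eq_abs, Real.norm_eq_abs, Real.abs_exp]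
  calc _ ≤ K * Real.exp (1 / 2 * ‖x‖ ^ 2) * Real.exp (-‖x‖ ^ 2) := by gcongr; exact hK x
    _ = _ := by rw [mul_assoc, ← Real.exp_add]; congr 2; ring

/-- Integration of polynomials against a Gaussian weight. -/
noncomputable def gaussInt : 𝓟 →ₗ[ℝ] ℝ where
  toFun P := ∫ x : ℝ⁴, eval x.ofLp P * Real.exp (-‖x‖ ^ 2)
  map_add' P Q := by
    rw [← integral_add (integrable_eval_mul_gaussian P) (integrable_eval_mul_gaussian Q)]
    simp [add_mul]
  map_smul' c P := by
    rw [RingHom.id_apply, smul_eq_mul, ← integral_const_mul]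
    simp [mul_assoc]

theorem hasLineDerivAt_eval (P : 𝓟) (i : Fin 4) (x : ℝ⁴) :
    HasLineDerivAt ℝ (fun x : ℝ⁴ => eval x.ofLp P) (eval x.ofLp (pderiv i P)) x
      (EuclideanSpace.single i 1) := by
  induction P using MvPolynomial.induction_on with
  | C a => simpa [HasLineDerivAt] using hasDerivAt_const (0 : ℝ) a
  | add p q hp hq =>
    simp only [map_add]
    exact HasDerivAt.add hp hq
  | mul_X p j hp =>
    have hX : HasLineDerivAt ℝ (fun x : ℝ⁴ => x.ofLp j) (eval x.ofLp (pderiv i (X j))) x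
        (EuclideanSpace.single i 1) := by
      have h1 : HasDerivAt (fun t : ℝ => x j + t * (EuclideanSpace.single i (1 : ℝ) : ℝ⁴) j)
          (1 * (EuclideanSpace.single i (1 : ℝ) : ℝ⁴) j) 0 :=
        ((hasDerivAt_id (0 : ℝ)).mul_const _).const_add _
      have h2 : eval x.ofLp (pderiv i (X j)) = 1 * (EuclideanSpace.single i (1 : ℝ) : ℝ⁴) j := by
        rw [pderiv_X, Pi.single_apply, PiLp.single_apply]
        split_ifs <;> simp
      rw [h2]
      exact h1
    have h := HasDerivAt.mul hp hX
    simp only [zero_smul, add_zero] at h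
    simp only [map_mul, pderiv_mul, map_add, eval_X]
    exact h

theorem hasLineDerivAt_gaussian (i : Fin 4) (x : ℝ⁴) :
    HasLineDerivAt ℝ (fun x : ℝ⁴ => Real.exp (-‖x‖ ^ 2)) (-(2 * x i) * Real.exp (-‖x‖ ^ 2)) x
      (EuclideanSpace.single i 1) := by
  have h1 : HasFDerivAt (fun x : ℝ⁴ => Real.exp (-‖x‖ ^ 2))
      (Real.exp (-‖x‖ ^ 2) • -((2 : ℕ) • (innerSL ℝ x) : ℝ⁴ →L[ℝ] ℝ)) x :=
    ((hasStrictFDerivAt_norm_sq x).hasFDerivAt.neg).exp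
  have h2 := h1.hasLineDerivAt (EuclideanSpace.single i 1)
  have h3 : (Real.exp (-‖x‖ ^ 2) • -((2 : ℕ) • (innerSL ℝ x) : ℝ⁴ →L[ℝ] ℝ))
      (EuclideanSpace.single i 1) = -(2 * x i) * Real.exp (-‖x‖ ^ 2) := by
    have hin : inner ℝ x (EuclideanSpace.single i (1 : ℝ)) = x i := by
      rw [EuclideanSpace.inner_single_right]; simp
    simp only [_root_.smul_apply, _root_.neg_apply, innerSL_apply_apply,
      hin, smul_eq_mul, nsmul_eq_mul]
    push_cast
    ring
  exact h3 ▸ h2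

theorem gaussInt_pderiv (i : Fin 4) (P : 𝓟) : gaussInt (pderiv i P) = 2 * gaussInt (X i * P) := by
  have h := integral_bilinear_hasLineDerivAt_right_eq_neg_left_of_integrable (μ := volume)
    (B := ContinuousLinearMap.mul ℝ ℝ) (f := fun x : ℝ⁴ => eval x.ofLp P)
    (f' := fun x => eval x.ofLp (pderiv i P)) (g := fun x => Real.exp (-‖x‖ ^ 2))
    (g' := fun x => -(2 * x i) * Real.exp (-‖x‖ ^ 2)) (v := EuclideanSpace.single i 1)
    (integrable_eval_mul_gaussian _) (by
      refine ((integrable_eval_mul_gaussian (X i * P)).const_mul (-2)).congr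
        (Eventually.of_forall fun x => ?_)
      simp
      ring) (integrable_eval_mul_gaussian P) (fun x _ => hasLineDerivAt_eval P i x)
      (fun x _ => hasLineDerivAt_gaussian i x)
  simp only [ContinuousLinearMap.mul_apply'] at h
  have h2 : ∫ x : ℝ⁴, eval x.ofLp P * (-(2 * x i) * Real.exp (-‖x‖ ^ 2)) =
      -2 * gaussInt (X i * P) := by
    change _ = -2 * ∫ x : ℝ⁴, _
    rw [← integral_const_mul]
    refine integral_congr_ae (Eventually.of_forall fun x => ?_)
    simp
    ring
  have h3 : ∫ x : ℝ⁴, eval x.ofLp (pderiv i P) * Real.exp (-‖x‖ ^ 2) = gaussInt (pderiv i P) := rfl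
  rw [h2, h3] at h
  linarith

/-- Integrate the divergence of `P ∇Q` against the Gaussian: the Laplacian term vanishes and the
weight produces `x · ∇Q`, which is `d Q` by Euler's identity. -/
theorem gaussInt_mul_of_harmonic {d : ℕ} {P Q : 𝓟} (hQ : Q ∈ harmonicPoly d) :
    ∑ i, gaussInt (pderiv i P * pderiv i Q) = 2 * d * gaussInt (P * Q) := by
  have h1 : ∑ i, gaussInt (P * pderiv i (pderiv i Q)) = 0 := by
    have : polyLaplacian Q = 0 := hQ.2
    rw [← map_sum, ← Finset.mul_sum, ← polyLaplacian_apply, this, mul_zero, map_zero]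
  have h2 : ∀ i, gaussInt (pderiv i P * pderiv i Q) + gaussInt (P * pderiv i (pderiv i Q)) =
      2 * gaussInt (P * (X i * pderiv i Q)) := by
    intro i
    rw [← map_add, ← pderiv_mul, gaussInt_pderiv]
    congr 2
    ring
  have h3 : ∑ i, gaussInt (P * (X i * pderiv i Q)) = d * gaussInt (P * Q) := by
    rw [← map_sum, ← Finset.mul_sum, IsHomogeneous.sum_X_mul_pderiv hQ.1, mul_smul_comm, map_nsmul,
      nsmul_eq_mul]
  have h4 := Finset.sum_congr rfl fun i (_ : i ∈ Finset.univ) => h2 i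
  rw [Finset.sum_add_distrib, h1, add_zero, ← Finset.mul_sum, h3] at h4
  rw [h4]; ring

/-- The left side of the previous identity is symmetric in `P` and `Q`, so `(e - d) ∫ PQ = 0`. -/
theorem gaussInt_mul_eq_zero {d e : ℕ} (hde : d ≠ e) {P Q : 𝓟} (hP : P ∈ harmonicPoly d)
    (hQ : Q ∈ harmonicPoly e) : gaussInt (P * Q) = 0 := by
  have h1 := gaussInt_mul_of_harmonic (P := P) hQ
  have h2 := gaussInt_mul_of_harmonic (P := Q) hP
  simp_rw [mul_comm (pderiv _ Q)] at h2
  rw [h1, mul_comm Q P] at h2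
  have h3 : ((e : ℝ) - d) * gaussInt (P * Q) = 0 := by linarith
  have h4 : ((e : ℝ) - d) ≠ 0 := sub_ne_zero.2 (by exact_mod_cast hde.symm)
  exact (mul_eq_zero.1 h3).resolve_left h4

/-- Integration in polar coordinates. -/
theorem integral_eq_mul_of_polar {F : ℝ⁴ → ℝ} {g : S3 → ℝ} {k : ℝ → ℝ}
    (h : ∀ (θ : S3) (r : ℝ), 0 < r → F (r • (θ : ℝ⁴)) = g θ * k r) :
    ∫ x, F x = (∫ θ, g θ ∂surf) * ∫ r : Set.Ioi (0 : ℝ), k r ∂Measure.volumeIoiPow 3 := by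
  have hmp := (volume : Measure ℝ⁴).measurePreserving_homeomorphUnitSphereProd
  have hfr : Module.finrank ℝ ℝ⁴ - 1 = 3 := by simp
  rw [hfr] at hmp
  calc ∫ x, F x = ∫ x in ({0}ᶜ : Set ℝ⁴), F x := by
        rw [restrict_compl_singleton]
    _ = ∫ x : ({0}ᶜ : Set ℝ⁴), F x ∂(volume.comap Subtype.val) :=
        (integral_subtype_comap (measurableSet_singleton (0 : ℝ⁴)).compl F).symm
    _ = ∫ x : ({0}ᶜ : Set ℝ⁴), g (homeomorphUnitSphereProd ℝ⁴ x).1 *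
          k (homeomorphUnitSphereProd ℝ⁴ x).2 ∂(volume.comap Subtype.val) := by
        refine integral_congr_ae (Eventually.of_forall fun x => ?_)
        have := h (homeomorphUnitSphereProd ℝ⁴ x).1 (homeomorphUnitSphereProd ℝ⁴ x).2
          (homeomorphUnitSphereProd ℝ⁴ x).2.2
        dsimp only
        rw [← this]
        have hx : ‖(x : ℝ⁴)‖ ≠ 0 := norm_ne_zero_iff.2 x.2
        simp [smul_smul, hx]
    _ = ∫ p : S3 × Set.Ioi (0 : ℝ), g p.1 * k p.2
          ∂((volume : Measure ℝ⁴).toSphere.prod (Measure.volumeIoiPow 3)) :=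
        hmp.integral_comp (homeomorphUnitSphereProd ℝ⁴).measurableEmbedding
          fun p => g p.1 * k p.2
    _ = _ := integral_prod_mul g fun r : Set.Ioi (0 : ℝ) => k r

/-- In polar coordinates the Gaussian integral is the spherical integral times a radial factor. The
factor is nonzero because it also divides the positive integral of `‖x‖^d exp (-‖x‖²)`. -/
theorem integral_restrictS3_eq_zero {d : ℕ} {P : 𝓟} (hP : P.IsHomogeneous d)
    (h : gaussInt P = 0) : ∫ x, restrictS3 P x ∂surf = 0 := by
  have h1 := integral_eq_mul_of_polar (F := fun x => eval x.ofLp P * Real.exp (-‖x‖ ^ 2))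
    (g := restrictS3 P) (k := fun r => r ^ d * Real.exp (-r ^ 2)) (fun θ r hr => by
      rw [WithLp.ofLp_smul, eval_smul_of_isHomogeneous hP, norm_smul, norm_eq_of_mem_sphere,
        mul_one, Real.norm_eq_abs, sq_abs, restrictS3_apply]
      ring)
  have h2 := integral_eq_mul_of_polar (F := fun x => ‖x‖ ^ d * Real.exp (-‖x‖ ^ 2))
    (g := fun _ => 1) (k := fun r => r ^ d * Real.exp (-r ^ 2)) (fun θ r hr => by
      rw [norm_smul, norm_eq_of_mem_sphere, mul_one, Real.norm_eq_abs, sq_abs, abs_of_pos hr,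
        one_mul])
  have h3 : 0 < ∫ x : ℝ⁴, ‖x‖ ^ d * Real.exp (-‖x‖ ^ 2) := by
    have hint : Integrable fun x : ℝ⁴ => ‖x‖ ^ d * Real.exp (-‖x‖ ^ 2) := by
      refine ((integrable_exp_neg_mul_norm_sq one_pos).add
        (integrable_eval_mul_gaussian (normSqPoly ^ d))).mono'
        (by fun_prop) (Eventually.of_forall fun x => ?_)
      have he : eval x.ofLp (normSqPoly ^ d) = (‖x‖ ^ d) ^ 2 := by
        rw [map_pow, ← pow_mul, mul_comm, pow_mul, EuclideanSpace.real_norm_sq_eq]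
        simp [normSqPoly, sq]
      rw [Real.norm_of_nonneg (by positivity), Pi.add_apply, he, one_mul, ← one_add_mul]
      gcongr
      nlinarith [sq_nonneg (‖x‖ ^ d - 1)]
    rw [integral_pos_iff_support_of_nonneg (fun x => by positivity) hint]
    refine lt_of_lt_of_le ?_ (measure_mono (s := ({0}ᶜ : Set ℝ⁴)) fun x hx => ?_)
    · exact (isOpen_compl_singleton).measure_pos _ ⟨EuclideanSpace.single 0 1, by simp⟩
    · have : 0 < ‖x‖ := norm_pos_iff.2 hx
      exact (by positivity : ‖x‖ ^ d * Real.exp (-‖x‖ ^ 2) ≠ 0)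
  rw [h2] at h3
  have h4 : gaussInt P = _ := h1
  rw [h] at h4
  exact (mul_eq_zero.1 h4.symm).resolve_right (right_ne_zero_of_mul h3.ne')

theorem inner_SphHarm_eq_zero {n m : ℕ+} (hnm : n ≠ m) (u : SphHarm n) (v : SphHarm m) :
    inner ℝ (u : L2S3) (v : L2S3) = 0 := by
  rw [inner_eq_integral_contRep]
  obtain ⟨P, hP, hPu⟩ := contRep_mem u
  obtain ⟨Q, hQ, hQv⟩ := contRep_mem v
  have hne : (n : ℕ) - 1 ≠ (m : ℕ) - 1 := by
    intro h
    apply hnm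
    apply PNat.eq
    have := n.pos
    have := m.pos
    omega
  have := integral_restrictS3_eq_zero (IsHomogeneous.mul hP.1 hQ.1) (gaussInt_mul_eq_zero hne hP hQ)
  rw [← hPu, ← hQv]
  simpa [restrictS3_apply] using this

end GaussianWeight

/-! ### Density of spherical harmonics in `L²`. -/

section Density

open MvPolynomial

local notation "𝓟" => MvPolynomial (Fin 4) ℝ

/-- Stone–Weierstrass: the coordinate functions already separate points. -/
theorem topologicalClosure_range_restrictS3 :
    (LinearMap.range restrictS3).topologicalClosure = ⊤ := by
  let A : 𝓟 →ₐ[ℝ] C(S3, ℝ) := AlgHom.ofLinearMap restrictS3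
    (by ext x; simp [restrictS3_apply]) (fun P Q => by ext x; simp [restrictS3_apply])
  have h := ContinuousMap.subalgebra_topologicalClosure_eq_top_of_separatesPoints A.range (by
    intro x y hxy
    by_contra hcon
    push Not at hcon
    refine hxy (Subtype.ext (PiLp.ext fun i => ?_))
    have := hcon _ ⟨restrictS3 (X i), ⟨X i, rfl⟩, rfl⟩
    simpa [restrictS3_apply] using this)
  rw [eq_top_iff]
  intro g _
  have hg : g ∈ A.range.topologicalClosure := h ▸ Algebra.mem_top
  exact hg

theorem topologicalClosure_iSup_SphHarm : (⨆ n, SphHarm n).topologicalClosure = ⊤ := by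
  have h1 := (ContinuousMap.toLp_denseRange ℝ surf ℝ (p := 2)
    (by simp)).topologicalClosure_map_submodule topologicalClosure_range_restrictS3
  rw [eq_top_iff, ← h1]
  refine Submodule.topologicalClosure_mono ?_
  rintro _ ⟨_, ⟨P, rfl⟩, rfl⟩
  have h2 := Submodule.mem_map_of_mem (f := (ContinuousMap.toLp 2 surf ℝ).toLinearMap)
    (restrictS3_mem_iSup P)
  rw [Submodule.map_iSup] at h2
  refine (iSup_le fun d => ?_ : _ ≤ ⨆ n, SphHarm n) h2
  refine le_trans (le_of_eq ?_) (le_iSup SphHarm d.succPNat)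
  rw [SphHarm_eq_map, contHarm]
  simp

end Density

/-! ### Comparison of `L^q` and `L²` norms. -/

section NormLq

theorem contRep_sub {n : ℕ+} (u v : SphHarm n) : contRep (u - v) = contRep u - contRep v := by
  simp [contRep]

theorem continuous_contRep (n : ℕ+) : Continuous (contRep : SphHarm n → C(S3, ℝ)) :=
  LinearMap.continuous_of_finiteDimensional
    ((contHarm n).subtype ∘ₗ (contHarmEquiv n).symm.toLinearMap)

theorem memLp_contRep {n : ℕ+} (u : SphHarm n) (p : ℝ≥0∞) : MemLp (contRep u) p surf :=
  (memLp_of_mem_SphHarm u.2 p).ae_eq (coeFn_ae_eq_contRep u)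

theorem normLq_eq_toReal_eLpNorm_contRep {n : ℕ+} (q : ℝ) (u : SphHarm n) :
    normLq q u = (eLpNorm (contRep u) (ENNReal.ofReal q) surf).toReal := by
  rw [normLq, eLpNorm_congr_ae (coeFn_ae_eq_contRep u)]

theorem normLq_nonneg (q : ℝ) (u : L2S3) : 0 ≤ normLq q u := ENNReal.toReal_nonneg

theorem normLq_rpow_eq {n : ℕ+} {q : ℝ} (hq : 0 < q) (u : SphHarm n) :
    normLq q u ^ q = ∫ x, |contRep u x| ^ q ∂surf := by
  have hI : 0 ≤ ∫ x, |contRep u x| ^ q ∂surf := integral_nonneg fun x => by positivity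
  rw [normLq_eq_toReal_eLpNorm_contRep, (memLp_contRep u _).eLpNorm_eq_integral_rpow_norm
    (by simpa using hq) ENNReal.ofReal_ne_top, ENNReal.toReal_ofReal hq.le,
    ENNReal.toReal_ofReal (by positivity)]
  exact Real.rpow_inv_rpow hI hq.ne'

theorem normLq_sub_le {n : ℕ+} {q : ℝ} (hq : 1 ≤ q) (u v : SphHarm n) :
    normLq q u - normLq q v ≤ normLq q ((u - v : SphHarm n) : L2S3) := by
  simp only [normLq_eq_toReal_eLpNorm_contRep]
  rw [sub_le_iff_le_add, ← ENNReal.toReal_add (memLp_contRep _ _).eLpNorm_ne_top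
    (memLp_contRep _ _).eLpNorm_ne_top]
  refine ENNReal.toReal_mono (ENNReal.add_ne_top.2 ⟨(memLp_contRep _ _).eLpNorm_ne_top,
    (memLp_contRep _ _).eLpNorm_ne_top⟩) ?_
  have hq1 : 1 ≤ ENNReal.ofReal q := by simpa using hq
  have h := eLpNorm_add_le (memLp_contRep (u - v) (ENNReal.ofReal q)).aestronglyMeasurable
    (memLp_contRep v (ENNReal.ofReal q)).aestronglyMeasurable hq1
  have e : ⇑(contRep (u - v)) + ⇑(contRep v) = contRep u := by
    rw [contRep_sub, ContinuousMap.coe_sub, sub_add_cancel]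
  rwa [e] at h

theorem norm_zonal (n : ℕ+) (x : S3) : ‖zonal n x‖ = (√(surf.real Set.univ))⁻¹ * n := by
  have hV := surf_real_univ_pos
  have hs : 0 < √(surf.real Set.univ) := Real.sqrt_pos.2 hV
  rw [← sq_eq_sq₀ (norm_nonneg _) (by positivity), mul_pow, inv_pow, Real.sq_sqrt hV.le,
    ← norm_zonal_sq n x]
  field_simp

theorem abs_contRep_le {n : ℕ+} (u : SphHarm n) (x : S3) :
    |contRep u x| ≤ (√(surf.real Set.univ))⁻¹ * n * ‖u‖ := by
  rw [← inner_zonal, ← norm_zonal n x]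
  exact abs_real_inner_le_norm _ _

theorem integral_contRep_sq {n : ℕ+} (u : SphHarm n) : ∫ x, contRep u x ^ 2 ∂surf = ‖u‖ ^ 2 := by
  rw [← real_inner_self_eq_norm_sq, Submodule.coe_inner, inner_eq_integral_contRep]
  simp [sq]

theorem integrable_continuousMap_S3 (g : C(S3, ℝ)) : Integrable g surf :=
  g.continuous.integrable_of_hasCompactSupport (HasCompactSupport.of_compactSpace _)

/-- The constant in the comparison of `L^q` norms and `L²` norms of spherical harmonics. -/
noncomputable def lipConst : ℝ := max 1 (√(surf.real Set.univ))⁻¹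

theorem lipConst_pos : 0 < lipConst := lt_max_of_lt_left one_pos

/-- Write `|u|^q = |u|^(q-2) u²`, bound the first factor by the zonal sup estimate and integrate the
second. -/
theorem normLq_le {n : ℕ+} {q : ℝ} (hq : 2 ≤ q) (u : SphHarm n) :
    normLq q u ≤ lipConst * (n : ℝ) ^ (1 - 2 / q) * ‖u‖ := by
  have hn : (0 : ℝ) < n := by exact_mod_cast n.pos
  have hq0 : 0 < q := by linarith
  have hK := lipConst_pos
  have hV : 0 < √(surf.real Set.univ) := Real.sqrt_pos.2 surf_real_univ_pos
  set b : ℝ := (√(surf.real Set.univ))⁻¹ * n with hb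
  have hb0 : 0 < b := by positivity
  have h1 : ∫ x, |contRep u x| ^ q ∂surf ≤ (b * ‖u‖) ^ (q - 2) * ‖u‖ ^ 2 := by
    rw [← integral_contRep_sq, ← integral_const_mul]
    refine integral_mono (integrable_continuousMap_S3
      ⟨_, (contRep u).continuous.abs.rpow_const fun x => .inr hq0.le⟩)
      ((integrable_continuousMap_S3 ⟨_, (contRep u).continuous.pow 2⟩).const_mul _) fun x => ?_
    have e : |contRep u x| ^ q = |contRep u x| ^ (q - 2) * contRep u x ^ 2 := by
      rw [← sq_abs (contRep u x), ← Real.rpow_natCast |contRep u x| 2,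
        ← Real.rpow_add_of_nonneg (abs_nonneg _) (by linarith) (by norm_num)]
      congr 1
      push_cast
      ring
    dsimp only
    rw [e]
    gcongr
    exact abs_contRep_le u x
  rw [← normLq_rpow_eq hq0] at h1
  have h2 : (b * ‖u‖) ^ (q - 2) * ‖u‖ ^ 2 = (b ^ (1 - 2 / q) * ‖u‖) ^ q := by
    rw [Real.mul_rpow hb0.le (norm_nonneg _), Real.mul_rpow (by positivity) (norm_nonneg _),
      ← Real.rpow_mul hb0.le, mul_assoc, ← Real.rpow_natCast ‖u‖ 2,
      ← Real.rpow_add_of_nonneg (norm_nonneg _) (by linarith) (by norm_num)]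
    congr 2
    · field_simp
    · push_cast; ring
  rw [h2, Real.rpow_le_rpow_iff (normLq_nonneg _ _) (by positivity) hq0] at h1
  refine h1.trans ?_
  gcongr
  have he : 0 ≤ 1 - 2 / q := by
    rw [sub_nonneg, div_le_one hq0]; exact hq
  have he1 : 1 - 2 / q ≤ 1 := by
    have : 0 ≤ 2 / q := by positivity
    linarith
  rw [hb, Real.mul_rpow (by positivity) hn.le]
  gcongr
  -- The maximum with `1` in `lipConst` makes the bound uniform in the exponent `1 - 2/q`, which
  -- lies in `[0, 1]`.
  calc (√(surf.real Set.univ))⁻¹ ^ (1 - 2 / q) ≤ lipConst ^ (1 - 2 / q) := by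
        gcongr; exact le_max_right _ _
    _ ≤ lipConst ^ (1 : ℝ) := Real.rpow_le_rpow_of_exponent_le (le_max_left _ _) he1
    _ = lipConst := Real.rpow_one _

end NormLq

/-! ### Medians and concentration of the `L^q` norms. -/

section Median

variable {n : ℕ+} (f : OrthonormalBasis (Fin ((n : ℕ) ^ 2)) ℝ (SphHarm n)) {q : ℝ}

theorem normLq_repr_symm_sub_le (hq : 2 ≤ q)
    (a b : Metric.sphere (0 : EuclideanSpace ℝ (Fin ((n : ℕ) ^ 2))) 1) :
    normLq q (f.repr.symm a) - normLq q (f.repr.symm b) ≤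
      lipConst * (n : ℝ) ^ (1 - 2 / q) * ‖(a : EuclideanSpace ℝ (Fin ((n : ℕ) ^ 2))) - b‖ := by
  refine (normLq_sub_le (by linarith) _ _).trans ((normLq_le hq _).trans_eq ?_)
  rw [← map_sub, LinearIsometryEquiv.norm_map]

theorem continuous_normLq_repr_symm (hq : 2 ≤ q) :
    Continuous fun a : Metric.sphere (0 : EuclideanSpace ℝ (Fin ((n : ℕ) ^ 2))) 1 =>
      normLq q (f.repr.symm a) := by
  have hL : 0 ≤ lipConst * (n : ℝ) ^ (1 - 2 / q) := mul_nonneg lipConst_pos.le (by positivity)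
  refine (LipschitzWith.of_le_add_mul (lipConst * (n : ℝ) ^ (1 - 2 / q)).toNNReal
    fun a b => ?_).continuous
  rw [Real.coe_toNNReal _ hL, Subtype.dist_eq, dist_eq_norm]
  linarith [normLq_repr_symm_sub_le f hq a b]

/-- After Fubini, evaluation at fixed `x` is a linear form on the coefficient sphere whose vector
has norm `n/√V = √N/√V`, so its moments are bounded independently of `n`. -/
theorem lintegral_normLq_rpow_le (hq : 2 ≤ q) :
    ∫⁻ a, ENNReal.ofReal (normLq q (f.repr.symm a) ^ q) ∂unifSphere ((n : ℕ) ^ 2) ≤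
      ENNReal.ofReal (4 * (8 * (√(surf.real Set.univ))⁻¹ * √q) ^ q * surf.real Set.univ) := by
  have hq0 : 0 < q := by linarith
  have hN : 0 < (n : ℕ) ^ 2 := pow_pos n.pos 2
  have := isProbabilityMeasure_unifSphere hN
  set V := surf.real Set.univ with hV
  have hc : Continuous fun p : Metric.sphere (0 : EuclideanSpace ℝ (Fin ((n : ℕ) ^ 2))) 1 × S3 =>
      contRep (f.repr.symm p.1) p.2 := by
    have h1 : Continuous fun p : Metric.sphere (0 : EuclideanSpace ℝ (Fin ((n : ℕ) ^ 2))) 1 × S3 =>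
        contRep (f.repr.symm p.1) :=
      (continuous_contRep n).comp (f.repr.symm.continuous.comp
        (continuous_subtype_val.comp continuous_fst))
    exact h1.eval continuous_snd
  calc ∫⁻ a, ENNReal.ofReal (normLq q (f.repr.symm a) ^ q) ∂unifSphere ((n : ℕ) ^ 2)
      = ∫⁻ a, ∫⁻ x, ENNReal.ofReal (|contRep (f.repr.symm a) x| ^ q) ∂surf
          ∂unifSphere ((n : ℕ) ^ 2) := by
        refine lintegral_congr fun a => ?_
        have hint : Integrable (fun x => |contRep (f.repr.symm a) x| ^ q) surf :=
          integrable_continuousMap_S3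
            ⟨_, (contRep (f.repr.symm a)).continuous.abs.rpow_const fun x => .inr hq0.le⟩
        rw [normLq_rpow_eq hq0, ofReal_integral_eq_lintegral_ofReal hint
          (Eventually.of_forall fun x => by positivity)]
    _ = ∫⁻ x, ∫⁻ a, ENNReal.ofReal (|contRep (f.repr.symm a) x| ^ q)
          ∂unifSphere ((n : ℕ) ^ 2) ∂surf := by
        refine lintegral_lintegral_swap (Measurable.aemeasurable ?_)
        exact ENNReal.measurable_ofReal.comp (hc.measurable.abs.pow_const q)
    _ ≤ ∫⁻ x, ENNReal.ofReal (4 * (8 * (√V)⁻¹ * √q) ^ q) ∂surf := by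
        refine lintegral_mono fun x => ?_
        have e : ∀ a : Metric.sphere (0 : EuclideanSpace ℝ (Fin ((n : ℕ) ^ 2))) 1,
            contRep (f.repr.symm a) x = inner ℝ (a : EuclideanSpace ℝ (Fin ((n : ℕ) ^ 2)))
              (f.repr (zonal n x)) := by
          intro a
          rw [← inner_zonal, real_inner_comm, ← LinearIsometryEquiv.inner_map_map f.repr,
            LinearIsometryEquiv.apply_symm_apply]
        simp_rw [e]
        refine lintegral_abs_inner_rpow_le hN hq0 (by positivity) ?_
        rw [LinearIsometryEquiv.norm_map, norm_zonal]
        push_cast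
        rw [Real.sqrt_sq (by positivity)]
    _ = _ := by
        rw [lintegral_const, ENNReal.ofReal_mul (p := 4 * (8 * (√V)⁻¹ * √q) ^ q) (by positivity),
          hV, ofReal_measureReal]

/-- The medians of the `L^q` norms are `O(√q)`. -/
theorem median_normLq_le (hq : 2 ≤ q) {M : ℝ}
    (hM : IsMedian (unifSphere ((n : ℕ) ^ 2)) (fun a => normLq q (f.repr.symm a)) M) :
    M ≤ (8 * surf.real Set.univ + 1) * (8 * (√(surf.real Set.univ))⁻¹) * √q := by
  have hq0 : 0 < q := by linarith
  have hV := surf_real_univ_pos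
  rcases le_or_gt M 0 with h0 | h0
  · exact h0.trans (by positivity)
  have hm : Measurable fun a : Metric.sphere (0 : EuclideanSpace ℝ (Fin ((n : ℕ) ^ 2))) 1 =>
      ENNReal.ofReal (normLq q (f.repr.symm a) ^ q) := by
    have := (continuous_normLq_repr_symm f hq).measurable
    fun_prop
  -- Markov's inequality at level `M^q`, an event of probability at least `1/2`.
  have h1 := mul_meas_ge_le_lintegral (μ := unifSphere ((n : ℕ) ^ 2)) hm (ENNReal.ofReal (M ^ q))
  have h2 : 1 / 2 ≤ unifSphere ((n : ℕ) ^ 2)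
      {a | ENNReal.ofReal (M ^ q) ≤ ENNReal.ofReal (normLq q (f.repr.symm a) ^ q)} := by
    refine hM.1.trans (measure_mono fun a ha => ENNReal.ofReal_le_ofReal ?_)
    exact Real.rpow_le_rpow h0.le ha hq0.le
  have h3 : ENNReal.ofReal (M ^ q) * (1 / 2) ≤ _ :=
    ((mul_le_mul_right h2 _).trans h1).trans (lintegral_normLq_rpow_le f hq)
  replace h3 := ENNReal.toReal_mono ENNReal.ofReal_ne_top h3
  rw [ENNReal.toReal_mul, ENNReal.toReal_ofReal (by positivity),
    ENNReal.toReal_ofReal (by positivity)] at h3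
  simp only [one_div, ENNReal.toReal_inv, ENNReal.toReal_ofNat] at h3
  set V := surf.real Set.univ
  have h4 : M ^ q ≤ ((8 * V + 1) * (8 * (√V)⁻¹ * √q)) ^ q := by
    rw [Real.mul_rpow (by positivity) (by positivity)]
    -- The added `1` makes the base at least `1`, so the prefactor `8V` is absorbed into a `q`-th
    -- power for every `q`.
    have h5 : 8 * V ≤ (8 * V + 1) ^ q := by
      have := Real.rpow_le_rpow_of_exponent_le (x := 8 * V + 1) (by linarith)
        (show (1 : ℝ) ≤ q by linarith)
      rw [Real.rpow_one] at this
      linarith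
    have h6 : 0 ≤ (8 * (√V)⁻¹ * √q) ^ q := by positivity
    nlinarith
  rw [Real.rpow_le_rpow_iff h0.le (by positivity) hq0] at h4
  linarith

theorem rotated_eq (U : OGroup ((n : ℕ) ^ 2)) (k : Fin ((n : ℕ) ^ 2)) :
    rotated f U k = f.repr.symm (U.isometry (EuclideanSpace.single k 1)) := by
  rw [OGroup.isometry_single, rotated]

theorem haarO_normLq_sub_median_gt_le (hq : 2 ≤ q) {M : ℝ}
    (hM : IsMedian (unifSphere ((n : ℕ) ^ 2)) (fun a => normLq q (f.repr.symm a)) M) {r : ℝ}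
    (hr : 0 ≤ r) :
    (haarO ((n : ℕ) ^ 2)).real {U | ∃ k, r < |normLq q (rotated f U k : SphHarm n) - M|} ≤
      2 * (n : ℝ) ^ 2 * Real.exp (-(1 / (64 * lipConst ^ 2) * (n : ℝ) ^ (4 / q) * r ^ 2)) := by
  have hn : (0 : ℝ) < n := by exact_mod_cast n.pos
  have hq0 : 0 < q := by linarith
  have hN : 0 < (n : ℕ) ^ 2 := pow_pos n.pos 2
  have hK := lipConst_pos
  have := isProbabilityMeasure_unifSphere hN
  have := haarO_isProbabilityMeasure ((n : ℕ) ^ 2)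
  have hk : ∀ k, (haarO ((n : ℕ) ^ 2)).real {U | r < |normLq q (rotated f U k : SphHarm n) - M|} ≤
      2 * Real.exp (-(1 / (64 * lipConst ^ 2) * (n : ℝ) ^ (4 / q) * r ^ 2)) := by
    intro k
    let x : Metric.sphere (0 : EuclideanSpace ℝ (Fin ((n : ℕ) ^ 2))) 1 :=
      ⟨EuclideanSpace.single k 1, by simp⟩
    have hB : MeasurableSet {a : Metric.sphere (0 : EuclideanSpace ℝ (Fin ((n : ℕ) ^ 2))) 1 |
        r < |normLq q (f.repr.symm a) - M|} :=
      measurableSet_lt measurable_const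
        ((continuous_normLq_repr_symm f hq).sub continuous_const).abs.measurable
    have h1 := haarO_sphereMap_mem hN x hB
    have h2 := unifSphere_abs_sub_median_gt_le hN (L := lipConst * (n : ℝ) ^ (1 - 2 / q))
      (by positivity) (normLq_repr_symm_sub_le f hq) hM hr
    rw [measureReal_def, ← h1, ← measureReal_def] at h2
    -- Dimension `n²` over squared Lipschitz constant of order `n^(2 - 4/q)` leaves `n^(4/q)`.
    have e : ((n : ℕ) ^ 2 : ℕ) * r ^ 2 / (64 * (lipConst * (n : ℝ) ^ (1 - 2 / q)) ^ 2) =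
        1 / (64 * lipConst ^ 2) * (n : ℝ) ^ (4 / q) * r ^ 2 := by
      have e1 : (n : ℝ) ^ (4 / q) * ((n : ℝ) ^ (1 - 2 / q)) ^ 2 = (n : ℝ) ^ 2 := by
        rw [← Real.rpow_natCast _ 2, ← Real.rpow_mul hn.le, ← Real.rpow_add hn,
          ← Real.rpow_natCast (n : ℝ) 2]
        congr 1
        push_cast
        field_simp
        ring
      push_cast
      rw [← e1]
      field_simp
    rw [e] at h2
    refine le_trans (le_of_eq ?_) h2
    congr 1
    ext U
    simp only [Set.mem_ofPred_eq, rotated_eq]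
    rfl
  have hU : {U | ∃ k, r < |normLq q (rotated f U k : SphHarm n) - M|} =
      ⋃ k, {U | r < |normLq q (rotated f U k : SphHarm n) - M|} := by
    ext U
    simp
  rw [hU]
  refine (measureReal_iUnion_fintype_le _).trans ((Finset.sum_le_sum fun k _ => hk k).trans_eq ?_)
  simp
  ring

end Median

/-! ### Choice of good bases and assembly. -/

/-- Constants for which the medians and the concentration inequality are controlled. -/
theorem exists_concentration_constants : ∃ c C : ℝ, 0 < c ∧ 0 < C ∧
    ∀ (n : ℕ+) (f : OrthonormalBasis (Fin ((n : ℕ) ^ 2)) ℝ (SphHarm n)) (q : ℝ), 2 ≤ q →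
      (∃ M : ℝ, IsMedian (unifSphere ((n : ℕ) ^ 2)) (fun a => normLq q (f.repr.symm a)) M) ∧
      ∀ M : ℝ, IsMedian (unifSphere ((n : ℕ) ^ 2)) (fun a => normLq q (f.repr.symm a)) M →
        M ≤ C * √q ∧
        ∀ r : ℝ, 0 ≤ r →
          (haarO ((n : ℕ) ^ 2)).real {U | ∃ k, r < |normLq q (rotated f U k : SphHarm n) - M|} ≤
            2 * (n : ℝ) ^ 2 * Real.exp (-(c * (n : ℝ) ^ (4 / q) * r ^ 2)) := by
  have hK := lipConst_pos
  have hV := surf_real_univ_pos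
  refine ⟨1 / (64 * lipConst ^ 2),
    (8 * surf.real Set.univ + 1) * (8 * (√(surf.real Set.univ))⁻¹), by positivity, by positivity,
    fun n f q hq => ⟨?_, fun M hM => ⟨median_normLq_le f hq hM, fun r hr =>
      haarO_normLq_sub_median_gt_le f hq hM hr⟩⟩⟩
  have := isProbabilityMeasure_unifSphere (N := (n : ℕ) ^ 2) (pow_pos n.pos 2)
  exact exists_isMedian _ (continuous_normLq_repr_symm f hq).measurable

/-- Since `n^(4/p) ≥ 1 + (4/p) log n`, the exponent contains `4 log n`, which more than absorbs the
union-bound factor `n²`. -/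
theorem sq_mul_exp_neg_rpow_le (n : ℕ+) {p : ℝ} (hp : 0 < p) :
    (n : ℝ) ^ 2 * Real.exp (-((n : ℝ) ^ (4 / p) * p)) ≤ Real.exp (-p) := by
  have hn : (1 : ℝ) ≤ n := by exact_mod_cast n.pos
  have hn0 : (0 : ℝ) < n := by linarith
  have hlog : 0 ≤ Real.log n := Real.log_nonneg hn
  have h1 : p + 4 * Real.log n ≤ (n : ℝ) ^ (4 / p) * p := by
    rw [Real.rpow_def_of_pos hn0]
    have := Real.add_one_le_exp (Real.log n * (4 / p))
    calc p + 4 * Real.log n = (Real.log n * (4 / p) + 1) * p := by field_simp; ring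
      _ ≤ _ := by gcongr
  have h2 : (n : ℝ) ^ 2 = Real.exp (2 * Real.log n) := by
    rw [mul_comm, Real.exp_mul, Real.exp_log hn0, Real.rpow_two]
  rw [h2, ← Real.exp_add, Real.exp_le_exp]
  linarith

/-- Rotated bases are orthonormal bases. -/
theorem exists_orthonormalBasis_rotated {n : ℕ+}
    (f : OrthonormalBasis (Fin ((n : ℕ) ^ 2)) ℝ (SphHarm n)) (U : OGroup ((n : ℕ) ^ 2)) :
    ∃ b : OrthonormalBasis (Fin ((n : ℕ) ^ 2)) ℝ (SphHarm n), ∀ k, b k = rotated f U k := by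
  refine ⟨((EuclideanSpace.basisFun _ ℝ).map U.isometry).map f.repr.symm, fun k => ?_⟩
  rw [rotated_eq]
  simp

theorem exists_orthonormalBasis_normLq_le : ∃ C : ℝ, ∀ n : ℕ+,
    ∃ b : OrthonormalBasis (Fin ((n : ℕ) ^ 2)) ℝ (SphHarm n),
      ∀ (m : ℕ) k, normLq (m + 3) (b k : SphHarm n) ≤ C * √(m + 3) := by
  obtain ⟨c, C, hc, hC, H⟩ := exists_concentration_constants
  refine ⟨C + (√c)⁻¹, fun n => ?_⟩
  let f : OrthonormalBasis (Fin ((n : ℕ) ^ 2)) ℝ (SphHarm n) :=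
    (stdOrthonormalBasis ℝ (SphHarm n)).reindex (finCongr (finrank_SphHarm n))
  have := haarO_isProbabilityMeasure ((n : ℕ) ^ 2)
  have hq : ∀ m : ℕ, (2 : ℝ) ≤ m + 3 := fun m => by
    have : (0 : ℝ) ≤ m := m.cast_nonneg
    linarith
  choose M hM using fun m : ℕ => (H n f (m + 3) (hq m)).1
  let B : ℕ → Set (OGroup ((n : ℕ) ^ 2)) := fun m =>
    {U | ∃ k, (√c)⁻¹ * √((m : ℝ) + 3) < |normLq (m + 3) (rotated f U k : SphHarm n) - M m|}
  -- The deviation `√(p/c)` cancels `c` and leaves probability at most `2 exp (-p)` with `p = m +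
  -- 3`. With `exp (-1) ≤ 1/2`, the shift by `3` makes these bounds sum to `1/2`; a shift by `2`
  -- would only give `1`.
  have hB : ∀ m, haarO ((n : ℕ) ^ 2) (B m) ≤ 4⁻¹ * 2⁻¹ ^ m := by
    intro m
    have hp : (0 : ℝ) < m + 3 := by positivity
    have h1 := ((H n f (m + 3) (hq m)).2 (M m) (hM m)).2 ((√c)⁻¹ * √((m : ℝ) + 3)) (by positivity)
    have e1 : c * (n : ℝ) ^ (4 / ((m : ℝ) + 3)) * ((√c)⁻¹ * √((m : ℝ) + 3)) ^ 2 =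
        (n : ℝ) ^ (4 / ((m : ℝ) + 3)) * (m + 3) := by
      rw [mul_pow, inv_pow, Real.sq_sqrt hc.le, Real.sq_sqrt hp.le]
      field_simp
    rw [e1, mul_assoc] at h1
    have h2 := sq_mul_exp_neg_rpow_le n hp
    have h3 : Real.exp (-((m : ℝ) + 3)) ≤ (1 / 2) ^ (m + 3) := by
      have e : -((m : ℝ) + 3) = ((m + 3 : ℕ) : ℝ) * (-1) := by push_cast; ring
      rw [e, Real.exp_nat_mul]
      have : (2 : ℝ) ≤ Real.exp 1 := by linarith [Real.add_one_le_exp (1 : ℝ)]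
      have : Real.exp (-1) ≤ 1 / 2 := by
        rw [Real.exp_neg, one_div]
        gcongr
      gcongr
    have h4 : (haarO ((n : ℕ) ^ 2)).real (B m) ≤ 1 / 4 * (1 / 2) ^ m := by
      refine h1.trans ?_
      rw [pow_add] at h3
      linarith
    rw [← ofReal_measureReal]
    refine (ENNReal.ofReal_le_ofReal h4).trans_eq ?_
    rw [ENNReal.ofReal_mul (by norm_num), ENNReal.ofReal_pow (by norm_num),
      ENNReal.ofReal_div_of_pos (by norm_num), ENNReal.ofReal_div_of_pos (by norm_num)]
    simp
  have hU : haarO ((n : ℕ) ^ 2) (⋃ m, B m) < 1 := by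
    refine (measure_iUnion_le _).trans_lt ((ENNReal.tsum_le_tsum hB).trans_lt ?_)
    rw [ENNReal.tsum_mul_left, ENNReal.tsum_geometric, ENNReal.one_sub_inv_two, inv_inv]
    rw [mul_comm, ← div_eq_mul_inv, ENNReal.div_lt_iff (by simp) (by simp)]
    norm_num
  obtain ⟨U, hU⟩ : ∃ U, U ∉ ⋃ m, B m := by
    by_contra hcon
    push Not at hcon
    rw [Set.eq_univ_of_forall hcon, measure_univ] at hU
    exact lt_irrefl _ hU
  obtain ⟨b, hb⟩ := exists_orthonormalBasis_rotated f U
  refine ⟨b, fun m k => ?_⟩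
  rw [hb]
  have h1 : ¬ (√c)⁻¹ * √((m : ℝ) + 3) < |normLq (m + 3) (rotated f U k : SphHarm n) - M m| :=
    fun h => hU (Set.mem_iUnion.2 ⟨m, k, h⟩)
  have h2 := (le_abs_self _).trans (not_lt.1 h1)
  have h3 := ((H n f (m + 3) (hq m)).2 (M m) (hM m)).1
  rw [add_mul]
  linarith

/-- Orthonormal bases of the spaces of spherical harmonics form a Hilbert basis of `L²(S³)`. -/
theorem exists_hilbertBasis_SphHarm
    (b : ∀ n : ℕ+, OrthonormalBasis (Fin ((n : ℕ) ^ 2)) ℝ (SphHarm n)) :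
    ∃ e : HilbertBasis (Σ n : ℕ+, Fin ((n : ℕ) ^ 2)) ℝ L2S3, ∀ n k, e ⟨n, k⟩ = (b n k : L2S3) := by
  let v : (Σ n : ℕ+, Fin ((n : ℕ) ^ 2)) → L2S3 := fun i => (b i.1 i.2 : L2S3)
  have hv : Orthonormal ℝ v := by
    refine ⟨fun i => (b i.1).orthonormal.1 i.2, ?_⟩
    rintro ⟨n, k⟩ ⟨m, l⟩ hne
    by_cases hnm : n = m
    · subst hnm
      have hkl : k ≠ l := fun h => hne (by rw [h])
      exact (b n).orthonormal.2 hkl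
    · exact inner_SphHarm_eq_zero hnm (b n k) (b m l)
  have hsp : ⊤ ≤ (Submodule.span ℝ (Set.range v)).topologicalClosure := by
    rw [← topologicalClosure_iSup_SphHarm]
    refine Submodule.topologicalClosure_mono (iSup_le fun n u hu => ?_)
    have h := (b n).sum_repr ⟨u, hu⟩
    have h2 : u = ∑ k, (b n).repr ⟨u, hu⟩ k • v ⟨n, k⟩ := by
      have := congrArg Subtype.val h
      rw [Submodule.coe_sum] at this
      exact this.symm
    rw [h2]
    exact Submodule.sum_mem _ fun k _ => Submodule.smul_mem _ _
      (Submodule.subset_span ⟨⟨n, k⟩, rfl⟩)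
  exact ⟨HilbertBasis.mk hv hsp, fun n k => by rw [HilbertBasis.coe_mk]⟩

theorem mainTheorem3 :
    (∀ n : ℕ+, Module.finrank ℝ (SphHarm n) = (n : ℕ) ^ 2) ∧
    (∃ c C : ℝ, 0 < c ∧ 0 < C ∧
      ∀ (n : ℕ+) (f : OrthonormalBasis (Fin ((n : ℕ) ^ 2)) ℝ (SphHarm n)) (q : ℝ), 2 ≤ q →
        (∃ M : ℝ, IsMedian (unifSphere ((n : ℕ) ^ 2)) (fun a => normLq q (f.repr.symm a)) M) ∧
        ∀ M : ℝ, IsMedian (unifSphere ((n : ℕ) ^ 2)) (fun a => normLq q (f.repr.symm a)) M →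
          M ≤ C * √q ∧
          ∀ r : ℝ, 0 ≤ r →
            (haarO ((n : ℕ) ^ 2)).real {U | ∃ k, r < |normLq q (rotated f U k : SphHarm n) - M|} ≤
              2 * (n : ℝ) ^ 2 * Real.exp (-(c * (n : ℝ) ^ (4 / q) * r ^ 2))) ∧
    (∃ (C : ℝ) (p : ℕ → ℝ) (e : HilbertBasis (Σ n : ℕ+, Fin ((n : ℕ) ^ 2)) ℝ L2S3),
      (∀ m, 2 ≤ p m) ∧ Tendsto p atTop atTop ∧ (∀ n k, e ⟨n, k⟩ ∈ SphHarm n) ∧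
      ∀ m n k, normLq (p m) (e ⟨n, k⟩) ≤ C * √(p m)) := by

  refine ⟨finrank_SphHarm, exists_concentration_constants, ?_⟩
  obtain ⟨C, hC⟩ := exists_orthonormalBasis_normLq_le
  choose b hb using hC
  obtain ⟨e, he⟩ := exists_hilbertBasis_SphHarm b
  refine ⟨C, fun m => m + 3, e, fun m => ?_, ?_, fun n k => ?_, fun m n k => ?_⟩
  · have : (0 : ℝ) ≤ m := m.cast_nonneg
    linarith
  · exact tendsto_atTop_add_const_right _ _ tendsto_natCast_atTop_atTop
  · rw [he]
    exact Subtype.coe_prop _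
  · rw [he]
    exact hb n m k
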